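/- Let $n \ge 0$ be an integer. For $t>0$ let $\mathrm d\mu_t(z) = (\pi t)^{-n} e^{-|z|^2/t}\,\mathrm dv(z)$ be the Gaussian probability measure on $\mathbb C^n$ ($\mathrm dv$ is Lebesgue measure and $|z|^2=\sum_j |z_j|^2$), let $H^2_t$ be the Fock space, i.e. the closed subspace of $L^2(\mathbb C^n,\mu_t)$ consisting of the (classes of) entire functions, and let $P^{(t)}\colon L^2(\mathbb C^n,\mu_t)\to H^2_t$ be the orthogonal projection. For a bounded measurable function $f\colon\mathbb C^n\to\mathbb C$ let $T_f^{(t)}\colon H^2_t\to H^2_t$, $T_f^{(t)}h = P^{(t)}(fh)$, be the Toeplitz operator with symbol $f$. For a multi-index $\alpha\in\mathbb N_0^n$ put $|\alpha|=\sum_j\alpha_j$, $\alpha!=\prod_j\alpha_j!$, $\partial^\alpha=\partial_{z_1}^{\alpha_1}\cdots\partial_{z_n}^{\alpha_n}$ and $\bar\partial^\alpha=\partial_{\bar z_1}^{\alpha_1}\cdots\partial_{\bar z_n}^{\alpha_n}$ (Wirtinger derivatives). Let $C^{2k}_b(\mathbb C^n)$ be the set of functions $\mathbb C^n\to\mathbb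 C$ that are $2k$ times continuously differentiable (in the real sense) and all of whose partial derivatives of order at most $2k$ (including order $0$) are bounded. Theorem. Let $k\ge 1$ and $f,g\in C^{2k}_b(\mathbb C^n)$. Then $$\lim_{t\to 0^+}\ \frac1{t^k}\,\Bigl\| T_f^{(t)}T_g^{(t)} - \sum_{\alpha\in\mathbb N_0^n,\ |\alpha|\le k} \frac{(-t)^{|\alpha|}}{\alpha!}\, T^{(t)}_{(\partial^\alpha f)(\bar\partial^\alpha g)}\Bigr\| = 0,$$ where $\|\cdot\|$ is the operator norm on $H^2_t$; that is, $T_f^{(t)}T_g^{(t)} = \sum_{|\alpha|\le k} \frac{(-t)^{|\alpha|}}{\alpha!} T^{(t)}_{(\partial^\alpha f)(\bar\partial^\alpha g)} + o(t^k)$ in operator norm as $t\to0^+$. -/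

import Mathlib

open MeasureTheory Filter Topology

namespace FockToeplitz

/-! ### Gaussian measures and the Fock space on `ℂⁿ` -/

/-- The Gaussian density `(π t)⁻ⁿ exp (-|z|² / t)` on `ℂⁿ`, where `|z|² = ∑ j, |z j|²`. -/
noncomputable def gaussianDensity (n : ℕ) (t : ℝ) (z : Fin n → ℂ) : ℝ :=
  ((Real.pi * t) ^ n)⁻¹ * Real.exp (-(∑ j, ‖z j‖ ^ 2) / t)

/-- The Gaussian probability measure `dμ_t = (π t)⁻ⁿ exp (-|z|² / t) dv` on `ℂⁿ`, where `dv` is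
Lebesgue measure. -/
noncomputable def gaussianMeasure (n : ℕ) (t : ℝ) : Measure (Fin n → ℂ) :=
  (volume : Measure (Fin n → ℂ)).withDensity fun z => ENNReal.ofReal (gaussianDensity n t z)

/-- The Fock space `H²_t`: the elements of `L²(ℂⁿ, μ_t)` which are represented by an entire
function. -/
noncomputable def fockSpace (n : ℕ) (t : ℝ) : Submodule ℂ (Lp ℂ 2 (gaussianMeasure n t)) where
  carrier := {u | ∃ F : (Fin n → ℂ) → ℂ, Differentiable ℂ F ∧ u =ᵐ[gaussianMeasure n t] F}
  zero_mem' := ⟨fun _ => 0, differentiable_const 0, Lp.coeFn_zero ℂ 2 (gaussianMeasure n t)⟩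
  add_mem' := by
    rintro u v ⟨F, hF, huF⟩ ⟨G, hG, hvG⟩
    exact ⟨F + G, hF.add hG, (Lp.coeFn_add u v).trans (huF.add hvG)⟩
  smul_mem' := by
    rintro c u ⟨F, hF, huF⟩
    exact ⟨c • F, hF.const_smul c, (Lp.coeFn_smul c u).trans (huF.const_smul c)⟩

/-! ### The Fock space is closed in `L²`, so that the orthogonal projection onto it exists -/

theorem measurePreserving_smul_circle (n : ℕ) (a : ℂ) (ha : ‖a‖ = 1) :
    MeasurePreserving (fun w : Fin n → ℂ => a • w) volume volume := by
  have h1 : MeasurePreserving (fun x : ℂ => a * x) volume volume :=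
    (rotation ⟨a, mem_sphere_zero_iff_norm.2 ha⟩).measurePreserving
  exact volume_preserving_pi (fun _ : Fin n => h1)

theorem setIntegral_smul_circle {n : ℕ} (F : (Fin n → ℂ) → ℂ) (a : ℂ) (ha : ‖a‖ = 1) :
    ∫ w in Metric.closedBall (0 : Fin n → ℂ) 1, F (a • w)
      = ∫ w in Metric.closedBall (0 : Fin n → ℂ) 1, F w := by
  have ha0 : a ≠ 0 := by
    rintro rfl
    simp at ha
  have hme : MeasurableEmbedding (fun w : Fin n → ℂ => a • w) :=
    (Homeomorph.smulOfNeZero a ha0).measurableEmbedding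
  have h := (measurePreserving_smul_circle n a ha).setIntegral_preimage_emb hme F
    (Metric.closedBall 0 1)
  have hpre : (fun w : Fin n → ℂ => a • w) ⁻¹' Metric.closedBall 0 1 = Metric.closedBall 0 1 := by
    ext w
    simp [norm_smul, ha]
  rwa [hpre] at h

/-- Mean value property of entire functions over polydiscs of radius `1`. -/
theorem mean_value {n : ℕ} {F : (Fin n → ℂ) → ℂ} (hF : Differentiable ℂ F) (z : Fin n → ℂ) :
    ∫ w in Metric.closedBall (0 : Fin n → ℂ) 1, F (z + w)
      = (volume.real (Metric.closedBall (0 : Fin n → ℂ) 1) : ℂ) * F z := by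
  set B : Set (Fin n → ℂ) := Metric.closedBall 0 1 with hB
  have hpi : (0 : ℝ) < 2 * Real.pi := by positivity
  have hcirc : ∀ w : Fin n → ℂ,
      ∫ θ in (0 : ℝ)..2 * Real.pi, F (z + circleMap 0 1 θ • w) = (2 * Real.pi : ℝ) • F z := by
    intro w
    have hd : Differentiable ℂ (fun x : ℂ => F (z + x • w)) := by fun_prop
    have h := hd.diffContOnCl (s := Metric.ball (0 : ℂ) |1|) |>.circleAverage
    rw [Real.circleAverage_def] at h
    simp only [zero_smul, add_zero] at h
    rw [← h, smul_smul, mul_inv_cancel₀ hpi.ne', one_smul]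
  have hrot : ∀ θ : ℝ, ∫ w in B, F (z + circleMap 0 1 θ • w) = ∫ w in B, F (z + w) := fun θ =>
    setIntegral_smul_circle (fun w => F (z + w)) (circleMap 0 1 θ) (by simp)
  have hcont : Continuous (fun p : ℝ × (Fin n → ℂ) => F (z + circleMap 0 1 p.1 • p.2)) := by
    have h1 : Continuous F := hF.continuous
    have h2 : Continuous (circleMap 0 1) := continuous_circleMap 0 1
    fun_prop
  have hint : Integrable (Function.uncurry fun (θ : ℝ) (w : Fin n → ℂ) =>
      F (z + circleMap 0 1 θ • w))
      ((volume.restrict (Set.uIoc 0 (2 * Real.pi))).prod (volume.restrict B)) := by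
    rw [Measure.prod_restrict]
    have hK : IsCompact (Set.uIcc 0 (2 * Real.pi) ×ˢ B) :=
      isCompact_uIcc.prod (isCompact_closedBall 0 1)
    have h3 : IntegrableOn (Function.uncurry fun (θ : ℝ) (w : Fin n → ℂ) =>
      F (z + circleMap 0 1 θ • w)) (Set.uIcc 0 (2 * Real.pi) ×ˢ B)
      ((volume : Measure ℝ).prod (volume : Measure (Fin n → ℂ))) :=
      hcont.continuousOn.integrableOn_compact hK
    exact h3.mono_set (Set.prod_mono Set.uIoc_subset_uIcc le_rfl)
  have hswap := intervalIntegral_integral_swap hint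
  simp only [hrot, hcirc] at hswap
  rw [intervalIntegral.integral_const, setIntegral_const, sub_zero, smul_comm] at hswap
  have h4 := smul_right_injective ℂ hpi.ne' hswap
  simpa using h4

theorem continuous_gaussianDensity (n : ℕ) (t : ℝ) : Continuous (gaussianDensity n t) := by
  unfold gaussianDensity
  fun_prop

theorem gaussianDensity_pos (n : ℕ) {t : ℝ} (ht : 0 < t) (z : Fin n → ℂ) :
    0 < gaussianDensity n t z := by
  have := Real.pi_pos
  unfold gaussianDensity
  positivity

/-- Point evaluations on entire functions are bounded with respect to the `L²(μ_t)`-norm,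
locally uniformly. -/
theorem exists_eval_bound (n : ℕ) {t : ℝ} (ht : 0 < t) (R : ℝ) :
    ∃ C : ℝ, 0 ≤ C ∧ ∀ F : (Fin n → ℂ) → ℂ, Differentiable ℂ F →
      ∀ u : Lp ℂ 2 (gaussianMeasure n t), u =ᵐ[gaussianMeasure n t] F →
        ∀ z : Fin n → ℂ, ‖z‖ ≤ R → ‖F z‖ ≤ C * ‖u‖ := by
  set K : Set (Fin n → ℂ) := Metric.closedBall 0 (R + 1) with hK
  set B : Set (Fin n → ℂ) := Metric.closedBall 0 1 with hB
  obtain ⟨c, hc, hcK⟩ : ∃ c : ℝ, 0 < c ∧ ∀ w ∈ K, c ≤ gaussianDensity n t w := by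
    rcases K.eq_empty_or_nonempty with h | h
    · exact ⟨1, one_pos, by simp [h]⟩
    · obtain ⟨w₀, -, h₀⟩ := (isCompact_closedBall (0 : Fin n → ℂ) (R + 1)).exists_isMinOn h
        (continuous_gaussianDensity n t).continuousOn
      exact ⟨_, gaussianDensity_pos n ht w₀, fun w hw => h₀ hw⟩
  set V : ℝ := volume.real B with hV
  have hVpos : 0 < V :=
    ENNReal.toReal_pos (Metric.measure_closedBall_pos volume 0 one_pos).ne'
      (isCompact_closedBall 0 1).measure_lt_top.ne
  refine ⟨√((c * V)⁻¹), Real.sqrt_nonneg _, fun F hF u hu z hz => ?_⟩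
  have hmv := mean_value (hF.pow 2) z
  have h1 : ENNReal.ofReal V * ‖F z‖ₑ ^ 2 ≤ ∫⁻ w in B, ‖F (z + w)‖ₑ ^ 2 := by
    have := enorm_integral_le_lintegral_enorm (μ := volume.restrict B) fun w => (F ^ 2) (z + w)
    rw [hmv, enorm_mul] at this
    have e0 : ‖(V : ℂ)‖ₑ = ENNReal.ofReal V := by
      rw [← ofReal_norm, Complex.norm_real, Real.norm_of_nonneg hVpos.le]
    rw [← e0]
    simpa only [Pi.pow_apply, enorm_pow] using this
  have h2 : ∫⁻ w in B, ‖F (z + w)‖ₑ ^ 2 ≤ ∫⁻ w in K, ‖F w‖ₑ ^ 2 := by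
    have hmp : MeasurePreserving (fun w : Fin n → ℂ => z + w) volume volume :=
      measurePreserving_add_left volume z
    have hme : MeasurableEmbedding (fun w : Fin n → ℂ => z + w) := measurableEmbedding_addLeft z
    have hsub : B ⊆ (fun w : Fin n → ℂ => z + w) ⁻¹' K := by
      intro w hw
      simp only [hB, hK, Set.mem_preimage, mem_closedBall_zero_iff] at hw ⊢
      exact (norm_add_le z w).trans (add_le_add hz hw)
    refine (lintegral_mono_set hsub).trans_eq ?_
    exact hmp.setLIntegral_comp_preimage_emb hme (fun w => ‖F w‖ₑ ^ 2) K
  have h3 : ENNReal.ofReal c * ∫⁻ w in K, ‖F w‖ₑ ^ 2 ≤ ‖u‖ₑ ^ 2 := by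
    have e1 : ‖u‖ₑ ^ 2 = ∫⁻ w, ‖F w‖ₑ ^ 2 ∂gaussianMeasure n t := by
      rw [Lp.enorm_def, eLpNorm_congr_ae hu]
      have := eLpNorm_nnreal_pow_eq_lintegral (μ := gaussianMeasure n t) (f := F)
        (p := 2) two_ne_zero
      simpa using this
    have hmeas : Measurable fun z => ENNReal.ofReal (gaussianDensity n t z) :=
      (continuous_gaussianDensity n t).measurable.ennreal_ofReal
    have hFm : Measurable fun w => ‖F w‖ₑ ^ 2 := hF.continuous.measurable.enorm.pow_const 2
    rw [e1, gaussianMeasure, lintegral_withDensity_eq_lintegral_mul _ hmeas hFm,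
      ← lintegral_const_mul _ hFm]
    refine le_trans ?_ (setLIntegral_le_lintegral K _)
    refine setLIntegral_mono (hmeas.mul hFm) fun w hw => ?_
    exact mul_le_mul_left (ENNReal.ofReal_le_ofReal (hcK w hw)) _
  have h4 : ENNReal.ofReal (c * V * ‖F z‖ ^ 2) ≤ ENNReal.ofReal (‖u‖ ^ 2) := by
    rw [ENNReal.ofReal_mul (by positivity), ENNReal.ofReal_mul hc.le, mul_assoc,
      ENNReal.ofReal_pow (norm_nonneg _), ENNReal.ofReal_pow (norm_nonneg _),
      ofReal_norm, ofReal_norm]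
    exact (mul_le_mul_right (h1.trans h2) _).trans h3
  have h5 : c * V * ‖F z‖ ^ 2 ≤ ‖u‖ ^ 2 := (ENNReal.ofReal_le_ofReal_iff (by positivity)).1 h4
  have hcV : 0 < c * V := by positivity
  have h6 : ‖F z‖ ^ 2 ≤ (√((c * V)⁻¹) * ‖u‖) ^ 2 := by
    rw [mul_pow, Real.sq_sqrt (by positivity), inv_mul_eq_div, le_div_iff₀ hcV]
    linarith
  exact le_of_sq_le_sq h6 (by positivity)

/-- Cauchy's estimate for the derivative of an entire function. -/
theorem norm_fderiv_le {n : ℕ} {F : (Fin n → ℂ) → ℂ} (hF : Differentiable ℂ F) {R C : ℝ}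
    (hC : 0 ≤ C) (hFC : ∀ z, ‖z‖ ≤ R + 1 → ‖F z‖ ≤ C) {z : Fin n → ℂ} (hz : ‖z‖ ≤ R) :
    ‖fderiv ℂ F z‖ ≤ C := by
  refine ContinuousLinearMap.opNorm_le_of_unit_norm (𝕜 := ℂ) hC fun v hv => ?_
  have hd : Differentiable ℂ fun x : ℂ => F (z + x • v) := by fun_prop
  have h := Complex.norm_deriv_le_of_forall_mem_sphere_norm_le (c := 0) (R := 1) (C := C)
    one_pos hd.diffContOnCl (fun x hx => hFC _ ?_)
  · have e : deriv (fun x : ℂ => F (z + x • v)) 0 = fderiv ℂ F z v := by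
      have := (hF z).lineDeriv_eq_fderiv (v := v)
      simpa [lineDeriv] using this
    simpa [e] using h
  · have hx1 : ‖x‖ = 1 := by simpa using hx
    calc ‖z + x • v‖ ≤ ‖z‖ + ‖x • v‖ := norm_add_le _ _
      _ ≤ R + 1 := by
        rw [norm_smul, hx1, hv]
        linarith

theorem isClosed_fockSpace (n : ℕ) {t : ℝ} (ht : 0 < t) :
    IsClosed (fockSpace n t : Set (Lp ℂ 2 (gaussianMeasure n t))) := by
  refine IsSeqClosed.isClosed fun u φ hu hlim => ?_
  choose F hF huF using hu
  have hcau : ∀ ε > 0, ∃ N, ∀ m ≥ N, ∀ l ≥ N, ‖u m - u l‖ < ε := by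
    simpa only [dist_eq_norm] using Metric.cauchySeq_iff.1 hlim.cauchySeq
  have hdiff : ∀ m l, ⇑(u m - u l) =ᵐ[gaussianMeasure n t] F m - F l := fun m l =>
    (Lp.coeFn_sub (u m) (u l)).trans ((huF m).sub (huF l))
  -- the functions and their derivatives are uniformly Cauchy on balls
  have hunif : ∀ R : ℝ, ∀ ε > 0, ∃ N, ∀ m ≥ N, ∀ l ≥ N, ∀ z : Fin n → ℂ, ‖z‖ ≤ R →
      ‖F m z - F l z‖ < ε ∧ ‖fderiv ℂ (F m) z - fderiv ℂ (F l) z‖ < ε := by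
    intro R ε hε
    obtain ⟨C, hC, hCF⟩ := exists_eval_bound n ht (R + 1)
    obtain ⟨N, hN⟩ := hcau (ε / (C + 1)) (by positivity)
    refine ⟨N, fun m hm l hl z hz => ?_⟩
    have hb : C * ‖u m - u l‖ < ε := by
      have h1 := hN m hm l hl
      rw [lt_div_iff₀ (by positivity)] at h1
      nlinarith [norm_nonneg (u m - u l)]
    have hd := (hF m).sub (hF l)
    have hp := hCF _ hd _ (hdiff m l)
    refine ⟨(hp z (by linarith)).trans_lt hb, ?_⟩
    have h2 := norm_fderiv_le hd (by positivity) hp hz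
    rw [fderiv_sub (hF m z) (hF l z)] at h2
    exact h2.trans_lt hb
  have hc1 : ∀ z, CauchySeq fun m => F m z := fun z => Metric.cauchySeq_iff.2 fun ε hε => by
    obtain ⟨N, hN⟩ := hunif ‖z‖ ε hε
    exact ⟨N, fun m hm l hl => by simpa [dist_eq_norm] using (hN m hm l hl z le_rfl).1⟩
  have hc2 : ∀ z, CauchySeq fun m => fderiv ℂ (F m) z := fun z =>
    Metric.cauchySeq_iff.2 fun ε hε => by
      obtain ⟨N, hN⟩ := hunif ‖z‖ ε hε
      exact ⟨N, fun m hm l hl => by simpa [dist_eq_norm] using (hN m hm l hl z le_rfl).2⟩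
  choose G hG using fun z => cauchySeq_tendsto_of_complete (hc1 z)
  choose G' hG' using fun z => cauchySeq_tendsto_of_complete (hc2 z)
  have hGd : Differentiable ℂ G := by
    intro z
    have hu : UniformCauchySeqOn (fun m => fderiv ℂ (F m)) atTop (Metric.ball 0 (‖z‖ + 1)) := by
      rw [Metric.uniformCauchySeqOn_iff]
      intro ε hε
      obtain ⟨N, hN⟩ := hunif (‖z‖ + 1) ε hε
      refine ⟨N, fun m hm l hl w hw => ?_⟩
      rw [dist_eq_norm]
      exact (hN m hm l hl w (mem_ball_zero_iff.1 hw).le).2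
    have hu' := hu.tendstoUniformlyOn_of_tendsto fun w _ => hG' w
    exact (hasFDerivAt_of_tendstoUniformlyOn Metric.isOpen_ball hu'
      (fun m w _ => (hF m w).hasFDerivAt) (fun w _ => hG w)
      (by simp : z ∈ Metric.ball (0 : Fin n → ℂ) (‖z‖ + 1))).differentiableAt
  refine ⟨G, hGd, ?_⟩
  obtain ⟨ns, hns, hae⟩ := (tendstoInMeasure_of_tendsto_Lp hlim).exists_seq_tendsto_ae
  filter_upwards [hae, ae_all_iff.2 huF] with z hz hzF
  refine tendsto_nhds_unique hz ?_
  simp only [hzF]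
  exact (hG z).comp hns.tendsto_atTop

instance instHasOrthogonalProjectionFockSpace (n : ℕ) (t : Set.Ioi (0 : ℝ)) :
    (fockSpace n (t : ℝ)).HasOrthogonalProjection :=
  haveI : CompleteSpace (fockSpace n (t : ℝ)) :=
    (isClosed_fockSpace n t.2).completeSpace_coe
  inferInstance

/-! ### Toeplitz operators -/

/-- The operator `M_f` of multiplication by a bounded symbol `f` on `L²(ℂⁿ, μ_t)`. -/
noncomputable def mulOp {n : ℕ} {t : ℝ} (f : (Fin n → ℂ) → ℂ)
    (hf : MemLp f ⊤ (gaussianMeasure n t)) :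
    Lp ℂ 2 (gaussianMeasure n t) →L[ℂ] Lp ℂ 2 (gaussianMeasure n t) :=
  (ContinuousLinearMap.mul ℂ ℂ).holderL (gaussianMeasure n t) ⊤ 2 2 (hf.toLp f)

open Classical in
/-- The Toeplitz operator `T_f = P M_f : H²_t → H²_t` with (essentially) bounded measurable
symbol `f`, where `P` is the orthogonal projection of `L²(ℂⁿ, μ_t)` onto `H²_t`. (Symbols which
are not essentially bounded get the value `0`.) -/
noncomputable def toeplitz {n : ℕ} (t : Set.Ioi (0 : ℝ)) (f : (Fin n → ℂ) → ℂ) :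
    fockSpace n (t : ℝ) →L[ℂ] fockSpace n (t : ℝ) :=
  if hf : MemLp f ⊤ (gaussianMeasure n (t : ℝ)) then
    (fockSpace n (t : ℝ)).orthogonalProjectionOnto ∘L mulOp f hf ∘L (fockSpace n (t : ℝ)).subtypeL
  else 0

/-! ### Wirtinger derivatives and multi-indices -/

/-- `∂f/∂z_j = (∂f/∂x_j - i ∂f/∂y_j) / 2`. -/
noncomputable def wirtinger {n : ℕ} (j : Fin n) (f : (Fin n → ℂ) → ℂ) : (Fin n → ℂ) → ℂ :=
  fun z => (fderiv ℝ f z (Pi.single j 1) - Complex.I * fderiv ℝ f z (Pi.single j Complex.I)) / 2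

/-- `∂f/∂z̄_j = (∂f/∂x_j + i ∂f/∂y_j) / 2`. -/
noncomputable def wirtingerBar {n : ℕ} (j : Fin n) (f : (Fin n → ℂ) → ℂ) : (Fin n → ℂ) → ℂ :=
  fun z => (fderiv ℝ f z (Pi.single j 1) + Complex.I * fderiv ℝ f z (Pi.single j Complex.I)) / 2

/-- `∂^α f = ∂_1^{α_1} ⋯ ∂_n^{α_n} f`. -/
noncomputable def wirtingerPow {n : ℕ} (α : Fin n → ℕ) (f : (Fin n → ℂ) → ℂ) :
    (Fin n → ℂ) → ℂ :=
  (List.finRange n).foldr (fun j h => (wirtinger j)^[α j] h) f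

/-- `∂̄^α f = ∂̄_1^{α_1} ⋯ ∂̄_n^{α_n} f`. -/
noncomputable def wirtingerBarPow {n : ℕ} (α : Fin n → ℕ) (f : (Fin n → ℂ) → ℂ) :
    (Fin n → ℂ) → ℂ :=
  (List.finRange n).foldr (fun j h => (wirtingerBar j)^[α j] h) f

/-- The finite set of multi-indices `α ∈ ℕⁿ` with `|α| ≤ k`. -/
def multiIndices (n k : ℕ) : Finset (Fin n → ℕ) :=
  (Finset.Iic (fun _ => k)).filter fun α => ∑ j, α j ≤ k

theorem mem_multiIndices {n k : ℕ} {α : Fin n → ℕ} : α ∈ multiIndices n k ↔ ∑ j, α j ≤ k := by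
  simp only [multiIndices, Finset.mem_filter, Finset.mem_Iic, and_iff_right_iff_imp]
  intro h j
  exact (Finset.single_le_sum (fun i _ => Nat.zero_le (α i)) (Finset.mem_univ j)).trans h

/-- `f ∈ C^m_b(ℂⁿ)`: `f` is `m` times continuously differentiable in the real sense, and all its
derivatives up to order `m` are bounded. -/
def IsCb {n : ℕ} (m : ℕ) (f : (Fin n → ℂ) → ℂ) : Prop :=
  ContDiff ℝ m f ∧ ∀ i ≤ m, ∃ C : ℝ, ∀ z, ‖iteratedFDeriv ℝ i f z‖ ≤ C

end FockToeplitz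

/-! The complex Hermite polynomials $e_{\alpha,\beta}=\prod_j h_{\alpha_j,\beta_j}(z_j)$ form an
orthogonal basis of $L^2(\mu_t)$ in which $\bar\partial_j$ lowers the first index. Its
$L^2(\mu_t)$-adjoint, up to a factor $t$, is the raising operator $\bar z_j-t\partial_j$. Entire
functions have coefficients only at $\alpha=0$, and $e_{0,\beta}=z^\beta$ is entire, so the
projection onto the Fock space just discards all coefficients with $\alpha\ne0$
(`hermiteCoeff_orthogonalProjectionOnto`).

Let $h,h'$ be in the Fock space, and let $q_{\alpha,\beta}$ be the $(\alpha,\beta)$ term of the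
Parseval sum for $\langle\bar f h',gh\rangle$. Then $\langle h',T_fT_gh\rangle=\sum_\beta
q_{0,\beta}$. Since $\bar\partial_j h=0$, integration by parts puts all derivatives on the symbol:
the coefficient of $gh$ at $\alpha+\gamma$ is $t^{|\gamma|}$ times that of $(\bar\partial^\gamma
g)h$ at $\alpha$ (`hermiteCoeff_add_mul`), and likewise for $\bar fh'$. Comparing norms of the basis
vectors turns this into $\frac{t^{|\gamma|}}{\gamma!}\langle h',T_{\partial^\gamma
f\,\bar\partial^\gamma g}h\rangle=\sum_{\alpha,\beta}\binom{\alpha}{\gamma}q_{\alpha,\beta}$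
(`hasSum_multiChoose_mul`).

The expansion is therefore inclusion-exclusion,
$1_{\alpha=0}=\sum_\gamma(-1)^{|\gamma|}\binom{\alpha}{\gamma}$, truncated at $|\gamma|\le k$. The
Bonferroni-type bound `abs_alternating_sum_multiChoose_le` controls the error by
$\sum_{|\gamma|=k+1}\binom{\alpha}{\gamma}$. Applying the same identity to absolute values, together
with Cauchy-Schwarz, bounds the remainder by $t^{k+1}\sum_{|\gamma|=k+1}\|\partial^\gamma
f\|_\infty\|\bar\partial^\gamma g\|_\infty\|h'\|\|h\|$. Thus $k+1$ bounded derivatives already give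
$O(t^{k+1})$, and $k+1\le2k$. -/

namespace FockToeplitz

/-! ### Functions of exponential growth -/

/-- `u` is continuous and grows at most exponentially. -/
def ExpGrowth {n : ℕ} (u : (Fin n → ℂ) → ℂ) : Prop :=
  Continuous u ∧ ∃ C c : ℝ, 0 ≤ C ∧ 0 ≤ c ∧ ∀ z, ‖u z‖ ≤ C * Real.exp (c * ∑ j, ‖z j‖)

namespace ExpGrowth

variable {n : ℕ} {u v : (Fin n → ℂ) → ℂ}

theorem mul (hu : ExpGrowth u) (hv : ExpGrowth v) : ExpGrowth fun z => u z * v z := by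
  obtain ⟨hu0, C, c, hC, hc, hu⟩ := hu
  obtain ⟨hv0, D, d, hD, hd, hv⟩ := hv
  refine ⟨hu0.mul hv0, C * D, c + d, by positivity, by positivity, fun z => ?_⟩
  rw [norm_mul, add_mul, Real.exp_add]
  calc ‖u z‖ * ‖v z‖ ≤ (C * Real.exp (c * ∑ j, ‖z j‖)) * (D * Real.exp (d * ∑ j, ‖z j‖)) :=
        mul_le_mul (hu z) (hv z) (norm_nonneg _) (by positivity)
    _ = _ := by ring

theorem add (hu : ExpGrowth u) (hv : ExpGrowth v) : ExpGrowth fun z => u z + v z := by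
  obtain ⟨hu0, C, c, hC, hc, hu⟩ := hu
  obtain ⟨hv0, D, d, hD, hd, hv⟩ := hv
  refine ⟨hu0.add hv0, C + D, c + d, by positivity, by positivity, fun z => ?_⟩
  have hs : 0 ≤ ∑ j, ‖z j‖ := Finset.sum_nonneg fun _ _ => norm_nonneg _
  have h1 : Real.exp (c * ∑ j, ‖z j‖) ≤ Real.exp ((c + d) * ∑ j, ‖z j‖) := by gcongr; linarith
  have h2 : Real.exp (d * ∑ j, ‖z j‖) ≤ Real.exp ((c + d) * ∑ j, ‖z j‖) := by gcongr; linarith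
  calc ‖u z + v z‖ ≤ ‖u z‖ + ‖v z‖ := norm_add_le _ _
    _ ≤ C * Real.exp (c * ∑ j, ‖z j‖) + D * Real.exp (d * ∑ j, ‖z j‖) := add_le_add (hu z) (hv z)
    _ ≤ C * Real.exp ((c + d) * ∑ j, ‖z j‖) + D * Real.exp ((c + d) * ∑ j, ‖z j‖) := by gcongr
    _ = _ := by ring

theorem const (a : ℂ) : ExpGrowth fun _ : Fin n → ℂ => a :=
  ⟨continuous_const, ‖a‖, 0, norm_nonneg _, le_rfl, fun z => by simp⟩

theorem conj (hu : ExpGrowth u) : ExpGrowth fun z => star (u z) := by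
  obtain ⟨hu0, C, c, hC, hc, hu⟩ := hu
  exact ⟨hu0.star, C, c, hC, hc, fun z => by simpa using hu z⟩

theorem apply (j : Fin n) : ExpGrowth fun z : Fin n → ℂ => z j := by
  refine ⟨continuous_apply j, 1, 1, zero_le_one, zero_le_one, fun z => ?_⟩
  have h1 : ‖z j‖ ≤ ∑ j, ‖z j‖ :=
    Finset.single_le_sum (f := fun j => ‖z j‖) (fun i _ => norm_nonneg _) (Finset.mem_univ j)
  have h2 := Real.add_one_le_exp (∑ j, ‖z j‖)
  rw [one_mul, one_mul]
  linarith

theorem prod {ι : Type*} (s : Finset ι) {w : ι → (Fin n → ℂ) → ℂ} (hw : ∀ i ∈ s, ExpGrowth (w i)) :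
    ExpGrowth fun z => ∏ i ∈ s, w i z := by
  classical
  induction s using Finset.induction_on with
  | empty => simpa using const 1
  | insert i s hi ih =>
    simp only [Finset.prod_insert hi]
    exact (hw i (by simp)).mul (ih fun j hj => hw j (by simp [hj]))

theorem sum {ι : Type*} (s : Finset ι) {w : ι → (Fin n → ℂ) → ℂ} (hw : ∀ i ∈ s, ExpGrowth (w i)) :
    ExpGrowth fun z => ∑ i ∈ s, w i z := by
  classical
  induction s using Finset.induction_on with
  | empty => simpa using const 0
  | insert i s hi ih =>
    simp only [Finset.sum_insert hi]
    exact (hw i (by simp)).add (ih fun j hj => hw j (by simp [hj]))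

end ExpGrowth

/-! ### Integrals with respect to the Gaussian measure -/

theorem measurable_gaussianDensity (n : ℕ) (t : ℝ) : Measurable (gaussianDensity n t) :=
  (continuous_gaussianDensity n t).measurable

theorem integral_gaussianMeasure (n : ℕ) {t : ℝ} (ht : 0 < t) (u : (Fin n → ℂ) → ℂ) :
    ∫ z, u z ∂gaussianMeasure n t = ∫ z, (gaussianDensity n t z : ℂ) * u z := by
  rw [gaussianMeasure, integral_withDensity_eq_integral_toReal_smul
    (measurable_gaussianDensity n t).ennreal_ofReal (by simp)]
  congr 1 with z
  rw [ENNReal.toReal_ofReal (gaussianDensity_pos n ht z).le, Complex.real_smul]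

theorem integrable_gaussianMeasure_iff (n : ℕ) {t : ℝ} (ht : 0 < t) {u : (Fin n → ℂ) → ℂ} :
    Integrable u (gaussianMeasure n t) ↔ Integrable fun z => (gaussianDensity n t z : ℂ) * u z := by
  rw [gaussianMeasure, integrable_withDensity_iff_integrable_smul'
    (measurable_gaussianDensity n t).ennreal_ofReal (by simp)]
  refine integrable_congr (ae_of_all _ fun z => ?_)
  simp only
  rw [ENNReal.toReal_ofReal (gaussianDensity_pos n ht z).le, Complex.real_smul]

theorem gaussianDensity_eq_prod (n : ℕ) (t : ℝ) (z : Fin n → ℂ) :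
    gaussianDensity n t z = ∏ j, ((Real.pi * t)⁻¹ * Real.exp (-t⁻¹ * ‖z j‖ ^ 2)) := by
  rw [Finset.prod_mul_distrib, ← Real.exp_sum, gaussianDensity, ← Finset.mul_sum]
  simp only [Finset.prod_const, Finset.card_univ, Fintype.card_fin, inv_pow]
  congr 2
  ring

theorem integrable_exp_neg_mul_sq_norm {b : ℝ} (hb : 0 < b) :
    Integrable fun z : ℂ => Real.exp (-b * ‖z‖ ^ 2) := by
  have h := GaussianFourier.integrable_cexp_neg_mul_sq_norm_add (V := ℂ) (b := (b : ℂ))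
    (by simpa using hb) 0 0
  refine h.norm.congr (ae_of_all _ fun z => ?_)
  simp only [inner_zero_left, Complex.norm_exp]
  congr 1
  norm_cast
  simp

theorem isProbabilityMeasure_gaussianMeasure (n : ℕ) {t : ℝ} (ht : 0 < t) :
    IsProbabilityMeasure (gaussianMeasure n t) := by
  have hpi := Real.pi_pos
  refine ⟨?_⟩
  rw [gaussianMeasure, withDensity_apply _ MeasurableSet.univ, Measure.restrict_univ,
    ← ofReal_integral_eq_lintegral_ofReal]
  · simp only [gaussianDensity_eq_prod]
    rw [integral_fintype_prod_volume_eq_prod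
      (fun (_ : Fin n) (x : ℂ) => (Real.pi * t)⁻¹ * Real.exp (-t⁻¹ * ‖x‖ ^ 2))]
    rw [integral_const_mul, GaussianFourier.integral_rexp_neg_mul_sq_norm (inv_pos.2 ht)]
    have : (Real.pi * t)⁻¹ * (Real.pi / t⁻¹) ^ ((Module.finrank ℝ ℂ : ℝ) / 2) = 1 := by
      simp
      field_simp
    rw [this, Finset.prod_const_one, ENNReal.ofReal_one]
  · rw [funext (gaussianDensity_eq_prod n t)]
    exact Integrable.fintype_prod fun _ =>
      (integrable_exp_neg_mul_sq_norm (inv_pos.2 ht)).const_mul _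
  · exact ae_of_all _ fun z => (gaussianDensity_pos n ht z).le

theorem ExpGrowth.integrable {n : ℕ} {t : ℝ} (ht : 0 < t) {u : (Fin n → ℂ) → ℂ}
    (hu : ExpGrowth u) : Integrable u (gaussianMeasure n t) := by
  obtain ⟨hu0, C, c, hC, hc, hu⟩ := hu
  have hpi := Real.pi_pos
  rw [integrable_gaussianMeasure_iff n ht]
  -- Half of the Gaussian absorbs the exponential: $c x\le x^2/(2t)+c^2t/2$ by completing the
  -- square.
  have h1 : Integrable fun z : Fin n → ℂ => C * ∏ j, ((Real.pi * t)⁻¹ * Real.exp (c ^ 2 * t / 2) *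
      Real.exp (-(t⁻¹ / 2) * ‖z j‖ ^ 2)) :=
    (Integrable.fintype_prod fun _ =>
      (integrable_exp_neg_mul_sq_norm (by positivity : 0 < t⁻¹ / 2)).const_mul _).const_mul _
  refine h1.mono' ?_ (ae_of_all _ fun z => ?_)
  · have := continuous_gaussianDensity n t
    exact Continuous.aestronglyMeasurable (by fun_prop)
  · rw [norm_mul, Complex.norm_real, Real.norm_of_nonneg (gaussianDensity_pos n ht z).le,
      gaussianDensity_eq_prod]
    calc _ ≤ (∏ j, ((Real.pi * t)⁻¹ * Real.exp (-t⁻¹ * ‖z j‖ ^ 2))) *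
          (C * Real.exp (c * ∑ j, ‖z j‖)) := by
          exact mul_le_mul_of_nonneg_left (hu z) (Finset.prod_nonneg fun j _ => by positivity)
      _ = C * ∏ j, ((Real.pi * t)⁻¹ * Real.exp (-t⁻¹ * ‖z j‖ ^ 2) * Real.exp (c * ‖z j‖)) := by
          rw [Finset.prod_mul_distrib (g := fun j => Real.exp (c * ‖z j‖)), ← Real.exp_sum,
            Finset.mul_sum]
          ring
      _ ≤ _ := by
          refine mul_le_mul_of_nonneg_left (Finset.prod_le_prod (fun j _ => by positivity)
            fun j _ => ?_) hC
          rw [mul_assoc, mul_assoc, ← Real.exp_add, ← Real.exp_add]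
          refine mul_le_mul_of_nonneg_left (Real.exp_le_exp.2 ?_) (by positivity)
          have : c ^ 2 * t / 2 + -(t⁻¹ / 2) * ‖z j‖ ^ 2 - (-t⁻¹ * ‖z j‖ ^ 2 + c * ‖z j‖)
              = (c * t - ‖z j‖) ^ 2 / (2 * t) := by
            field_simp
            ring
          have h2 : 0 ≤ (c * t - ‖z j‖) ^ 2 / (2 * t) := by positivity
          linarith

theorem ExpGrowth.memLp {n : ℕ} {t : ℝ} (ht : 0 < t) {u : (Fin n → ℂ) → ℂ}
    (hu : ExpGrowth u) : MemLp u 2 (gaussianMeasure n t) := by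
  rw [memLp_two_iff_integrable_sq_norm hu.1.aestronglyMeasurable]
  refine ((hu.mul hu).integrable ht).norm.congr (ae_of_all _ fun z => ?_)
  simp [sq]

/-! ### Complex Hermite polynomials -/

/-- The (scaled) complex Hermite polynomials of Itô in one variable: `h_{0,b} = z ^ b` and
`h_{a+1,b} = z̄ h_{a,b} - t ∂h_{a,b}`, where `∂h_{a,b} = b h_{a,b-1}`. -/
noncomputable def itoHermite (t : ℝ) : ℕ → ℕ → ℂ → ℂ
  | 0, b, z => z ^ b
  | a + 1, b, z => star z * itoHermite t a b z - t * b * itoHermite t a (b - 1) z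

/-- The commutator of multiplication by $z$ with the raising operator $\bar z-t\partial$ is $t$;
moving $z$ past $a$ raising operators produces the term $ta\,h_{a-1,b}$. This is the conjugate of
the defining recursion, whence the symmetry in `star_itoHermite`. -/
theorem mul_itoHermite (t : ℝ) (a b : ℕ) (z : ℂ) :
    z * itoHermite t a b z = itoHermite t a (b + 1) z + t * a * itoHermite t (a - 1) b z := by
  induction a generalizing b with
  | zero => simp [itoHermite, pow_succ']
  | succ a ih =>
    have h1 := ih b
    have h2 := ih (b - 1)
    -- The factor `b` makes the truncated `b - 1` harmless at `b = 0`; `h4` treats `a - 1` in the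
    -- same way.
    have h3 : z * (b * itoHermite t a (b - 1) z)
        = b * (itoHermite t a b z + t * a * itoHermite t (a - 1) (b - 1) z) := by
      rcases b with _ | b
      · simp
      · rw [Nat.add_sub_cancel] at h2 ⊢
        linear_combination ((b + 1 : ℕ) : ℂ) * h2
    have h4 : (a : ℂ) * itoHermite t a b z = a * (star z * itoHermite t (a - 1) b z
        - t * b * itoHermite t (a - 1) (b - 1) z) := by
      rcases a with _ | a
      · simp
      · simp [itoHermite]
    simp only [itoHermite, Nat.add_sub_cancel, Nat.cast_add, Nat.cast_one]
    linear_combination (star z) * h1 - t * h3 - t * h4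

theorem star_itoHermite (t : ℝ) (a b : ℕ) (z : ℂ) :
    star (itoHermite t a b z) = itoHermite t b a z := by
  induction a generalizing b with
  | zero =>
    induction b with
    | zero => simp [itoHermite]
    | succ b ih =>
      have : star (itoHermite t 0 b z) = star z ^ b := by simp [itoHermite]
      rw [this] at ih
      simp [itoHermite, ← ih, pow_succ']
  | succ a ih =>
    have h := mul_itoHermite t b a z
    simp only [itoHermite, star_sub, star_mul', ih, star_star]
    simp only [Complex.star_def, Complex.conj_ofReal, map_natCast]
    linear_combination h

/-- The two coefficients are $\partial h_{a,b}$ and $\bar\partial h_{a,b}$: each Wirtinger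
derivative lowers one index, by induction on the recursion. -/
theorem hasFDerivAt_itoHermite (t : ℝ) (a b : ℕ) (z : ℂ) :
    HasFDerivAt (itoHermite t a b)
      ((b * itoHermite t a (b - 1) z) • ContinuousLinearMap.id ℝ ℂ
        + (a * itoHermite t (a - 1) b z) • (Complex.conjCLE : ℂ →L[ℝ] ℂ)) z := by
  induction a generalizing b with
  | zero =>
    have h := ((hasDerivAt_pow b z).hasFDerivAt).restrictScalars ℝ
    convert! h using 1
    ext
    simp [itoHermite, mul_comm]
  | succ a ih =>
    have hc : HasFDerivAt (fun z : ℂ => star z) (Complex.conjCLE : ℂ →L[ℝ] ℂ) z :=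
      Complex.conjCLE.hasFDerivAt
    have h := (hc.mul (ih b)).sub ((ih (b - 1)).const_mul ((t : ℂ) * b))
    convert! h using 1
    have h4 : (a : ℂ) * itoHermite t a b z = a * (star z * itoHermite t (a - 1) b z
        - t * b * itoHermite t (a - 1) (b - 1) z) := by
      rcases a with _ | a
      · simp
      · simp [itoHermite]
    rw [Complex.star_def] at h4
    ext x
    simp [itoHermite]
    linear_combination (starRingEnd ℂ x) * h4

/-- Products `e_{α,β}(z) = ∏ j, h_{α_j,β_j}(z_j)` of complex Hermite polynomials. -/
noncomputable def multiHermite {n : ℕ} (t : ℝ) (α β : Fin n → ℕ) (z : Fin n → ℂ) : ℂ :=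
  ∏ j, itoHermite t (α j) (β j) (z j)

section multiHermite

variable {n : ℕ} (t : ℝ) (α β : Fin n → ℕ) (j : Fin n) (z : Fin n → ℂ)

theorem star_multiHermite : star (multiHermite t α β z) = multiHermite t β α z := by
  simp only [multiHermite, Complex.star_def, map_prod]
  exact Finset.prod_congr rfl fun i _ => star_itoHermite t _ _ _

theorem multiHermite_eq_mul_erase : multiHermite t α β z
    = itoHermite t (α j) (β j) (z j) * ∏ i ∈ Finset.univ.erase j, itoHermite t (α i) (β i) (z i) :=
  (Finset.mul_prod_erase _ _ (Finset.mem_univ j)).symm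

theorem multiHermite_add_single_left : multiHermite t (α + Pi.single j 1) β z
    = star (z j) * multiHermite t α β z - t * β j * multiHermite t α (β - Pi.single j 1) z := by
  have h1 : ∏ i ∈ Finset.univ.erase j, itoHermite t ((α + Pi.single j 1 : Fin n → ℕ) i) (β i) (z i)
      = ∏ i ∈ Finset.univ.erase j, itoHermite t (α i) (β i) (z i) :=
    Finset.prod_congr rfl fun i hi => by simp [Pi.single_eq_of_ne (Finset.ne_of_mem_erase hi)]
  have h2 : ∏ i ∈ Finset.univ.erase j, itoHermite t (α i) ((β - Pi.single j 1 : Fin n → ℕ) i) (z i)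
      = ∏ i ∈ Finset.univ.erase j, itoHermite t (α i) (β i) (z i) :=
    Finset.prod_congr rfl fun i hi => by simp [Pi.single_eq_of_ne (Finset.ne_of_mem_erase hi)]
  simp only [multiHermite_eq_mul_erase t _ _ j, h1, h2]
  simp only [Pi.add_apply, Pi.sub_apply, Pi.single_eq_same, itoHermite]
  ring

theorem mul_multiHermite : z j * multiHermite t α β z
    = multiHermite t α (β + Pi.single j 1) z + t * α j * multiHermite t (α - Pi.single j 1) β z := by
  have h := congrArg star (multiHermite_add_single_left t β α j z)
  simp only [star_sub, star_mul', star_star, star_multiHermite] at h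
  simp only [Complex.star_def, Complex.conj_ofReal, map_natCast] at h
  linear_combination -h

theorem star_mul_multiHermite : star (z j) * multiHermite t α β z
    = multiHermite t (α + Pi.single j 1) β z + t * β j * multiHermite t α (β - Pi.single j 1) z := by
  rw [multiHermite_add_single_left]
  ring

theorem multiHermite_zero_left : multiHermite t 0 β z = ∏ j, z j ^ β j := by
  simp [multiHermite, itoHermite]

theorem contDiff_itoHermite (a b : ℕ) : ContDiff ℝ 1 (itoHermite t a b) := by
  induction a generalizing b with
  | zero => exact contDiff_id.pow b
  | succ a ih =>
    have hc : ContDiff ℝ 1 (fun z : ℂ => star z) := Complex.conjCLE.contDiff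
    exact (hc.mul (ih b)).sub (contDiff_const.mul (ih (b - 1)))

theorem contDiff_multiHermite : ContDiff ℝ 1 (multiHermite t α β) :=
  contDiff_prod fun j _ => (contDiff_itoHermite t (α j) (β j)).comp (contDiff_apply ℝ ℂ j)

theorem fderiv_multiHermite_single (v : ℂ) : fderiv ℝ (multiHermite t α β) z (Pi.single j v)
    = β j * multiHermite t α (β - Pi.single j 1) z * v
      + α j * multiHermite t (α - Pi.single j 1) β z * star v := by
  have h1 : ∏ i ∈ Finset.univ.erase j, itoHermite t ((α - Pi.single j 1 : Fin n → ℕ) i) (β i) (z i)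
      = ∏ i ∈ Finset.univ.erase j, itoHermite t (α i) (β i) (z i) :=
    Finset.prod_congr rfl fun i hi => by simp [Pi.single_eq_of_ne (Finset.ne_of_mem_erase hi)]
  have h2 : ∏ i ∈ Finset.univ.erase j, itoHermite t (α i) ((β - Pi.single j 1 : Fin n → ℕ) i) (z i)
      = ∏ i ∈ Finset.univ.erase j, itoHermite t (α i) (β i) (z i) :=
    Finset.prod_congr rfl fun i hi => by simp [Pi.single_eq_of_ne (Finset.ne_of_mem_erase hi)]
  have h := HasFDerivAt.finsetProd (u := Finset.univ) (x := z) fun (i : Fin n) _ =>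
    (hasFDerivAt_itoHermite t (α i) (β i) (z i)).comp z
      ((ContinuousLinearMap.proj (R := ℝ) (φ := fun _ : Fin n => ℂ) i).hasFDerivAt)
  have h' : HasFDerivAt (multiHermite t α β) _ z := h
  rw [h'.fderiv, sum_apply, Finset.sum_eq_single j]
  · simp only [multiHermite_eq_mul_erase t _ _ j, h1, h2]
    simp
    ring
  · intro i _ hi
    simp [Pi.single_eq_of_ne hi]
  · simp

theorem wirtingerBar_multiHermite : wirtingerBar j (multiHermite t α β) z
    = α j * multiHermite t (α - Pi.single j 1) β z := by
  simp only [wirtingerBar, fderiv_multiHermite_single]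
  simp
  linear_combination ((1 / 2) * β j * multiHermite t α (β - Pi.single j 1) z
    - (1 / 2) * α j * multiHermite t (α - Pi.single j 1) β z) * Complex.I_mul_I

theorem expGrowth_multiHermite : ExpGrowth (multiHermite t α β) := by
  refine ExpGrowth.prod _ fun j _ => ?_
  generalize α j = a
  generalize β j = b
  induction a generalizing b with
  | zero => simpa [itoHermite] using ExpGrowth.prod (Finset.range b) fun _ _ => ExpGrowth.apply j
  | succ a ih =>
    have := ((ExpGrowth.apply j).conj.mul (ih b)).add
      ((ExpGrowth.const (-(t * b))).mul (ih (b - 1)))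
    simpa [itoHermite, sub_eq_add_neg] using this

end multiHermite

/-! ### Integration by parts -/

/-! ### Wirtinger derivatives: product rule and conjugation -/

section wirtinger

variable {n : ℕ} (j : Fin n)

/-- The real-linear functional `L ↦ (L e_j + i L (i e_j)) / 2`. -/
noncomputable def wirtingerBarL : ((Fin n → ℂ) →L[ℝ] ℂ) →L[ℝ] ℂ :=
  (2⁻¹ : ℂ) • (ContinuousLinearMap.apply ℝ ℂ (Pi.single j 1 : Fin n → ℂ)
    + Complex.I • ContinuousLinearMap.apply ℝ ℂ (Pi.single j Complex.I : Fin n → ℂ))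

theorem wirtingerBar_apply (f : (Fin n → ℂ) → ℂ) (z : Fin n → ℂ) :
    wirtingerBar j f z = wirtingerBarL j (fderiv ℝ f z) := by
  simp [wirtingerBar, wirtingerBarL]
  ring

theorem wirtingerBar_mul {f g : (Fin n → ℂ) → ℂ} {z : Fin n → ℂ} (hf : DifferentiableAt ℝ f z)
    (hg : DifferentiableAt ℝ g z) : wirtingerBar j (fun z => f z * g z) z
      = wirtingerBar j f z * g z + f z * wirtingerBar j g z := by
  simp only [wirtingerBar, fderiv_fun_mul hf hg]
  simp
  ring

theorem fderiv_star_apply (f : (Fin n → ℂ) → ℂ) (z v : Fin n → ℂ) :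
    fderiv ℝ (fun z => star (f z)) z v = star (fderiv ℝ f z v) := by
  have : fderiv ℝ (fun z => star (f z)) z = (Complex.conjCLE : ℂ →L[ℝ] ℂ) ∘L fderiv ℝ f z :=
    Complex.conjCLE.comp_fderiv
  rw [this]
  simp

theorem wirtingerBar_star (f : (Fin n → ℂ) → ℂ) (z : Fin n → ℂ) :
    wirtingerBar j (fun z => star (f z)) z = star (wirtinger j f z) := by
  simp only [wirtingerBar, wirtinger, fderiv_star_apply]
  simp

end wirtinger

/-- `u` is real differentiable and its derivative is bounded on bounded sets. -/
def HasLocBddDeriv {n : ℕ} (u : (Fin n → ℂ) → ℂ) : Prop :=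
  Differentiable ℝ u ∧ ∀ R : ℝ, ∃ C, ∀ z, ‖z‖ ≤ R → ‖fderiv ℝ u z‖ ≤ C

section integrationByParts

variable {n : ℕ}

theorem _root_.Continuous.exists_norm_le_of_norm_le {F : Type*} [NormedAddCommGroup F]
    {u : (Fin n → ℂ) → F} (hu : Continuous u) (R : ℝ) : ∃ C, ∀ z, ‖z‖ ≤ R → ‖u z‖ ≤ C := by
  obtain ⟨C, hC⟩ := (isCompact_closedBall (0 : Fin n → ℂ) R).exists_bound_of_continuousOn
    hu.continuousOn
  exact ⟨C, fun z hz => hC z (by simpa using hz)⟩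

theorem _root_.ContDiff.hasLocBddDeriv {u : (Fin n → ℂ) → ℂ} (hu : ContDiff ℝ 1 u) :
    HasLocBddDeriv u :=
  ⟨hu.differentiable one_ne_zero,
    (hu.continuous_fderiv one_ne_zero).exists_norm_le_of_norm_le⟩

theorem _root_.Differentiable.fderiv_real_eq {u : (Fin n → ℂ) → ℂ} (hu : Differentiable ℂ u)
    (z : Fin n → ℂ) : fderiv ℝ u z = (fderiv ℂ u z).restrictScalars ℝ :=
  ((hu z).hasFDerivAt.restrictScalars ℝ).fderiv

/-- Cauchy's estimate supplies the local bound directly, without continuity of the derivative. -/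
theorem _root_.Differentiable.hasLocBddDeriv {u : (Fin n → ℂ) → ℂ} (hu : Differentiable ℂ u) :
    HasLocBddDeriv u := by
  refine ⟨hu.restrictScalars ℝ, fun R => ?_⟩
  obtain ⟨C, hC⟩ := hu.continuous.exists_norm_le_of_norm_le (R + 1)
  refine ⟨max C 0, fun z hz => ?_⟩
  rw [hu.fderiv_real_eq]
  have := norm_fderiv_le hu (le_max_right C 0) (fun z hz => (hC z hz).trans (le_max_left _ _)) hz
  simpa using this

theorem _root_.Differentiable.wirtingerBar_eq_zero {u : (Fin n → ℂ) → ℂ} (hu : Differentiable ℂ u)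
    (j : Fin n) (z : Fin n → ℂ) : wirtingerBar j u z = 0 := by
  have h : (Pi.single j Complex.I : Fin n → ℂ) = Complex.I • Pi.single j (1 : ℂ) := by
    rw [← Pi.single_smul]
    simp
  simp only [wirtingerBar, hu.fderiv_real_eq, ContinuousLinearMap.coe_restrictScalars', h,
    map_smul, smul_eq_mul]
  linear_combination (1 / 2) * fderiv ℂ u z (Pi.single j 1) * Complex.I_mul_I

theorem HasLocBddDeriv.mul {u v : (Fin n → ℂ) → ℂ} (hu : HasLocBddDeriv u)
    (hv : HasLocBddDeriv v) : HasLocBddDeriv fun z => u z * v z := by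
  refine ⟨hu.1.mul hv.1, fun R => ?_⟩
  obtain ⟨C, hC⟩ := hu.2 R
  obtain ⟨D, hD⟩ := hv.2 R
  obtain ⟨C', hC'⟩ := hu.1.continuous.exists_norm_le_of_norm_le R
  obtain ⟨D', hD'⟩ := hv.1.continuous.exists_norm_le_of_norm_le R
  refine ⟨C' * D + D' * C, fun z hz => ?_⟩
  rw [fderiv_fun_mul (hu.1 z) (hv.1 z)]
  refine (norm_add_le _ _).trans ?_
  rw [norm_smul, norm_smul]
  have h1 := hC z hz
  have h2 := hC' z hz
  have h3 := hD z hz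
  have h4 := hD' z hz
  have := norm_nonneg (u z)
  have := norm_nonneg (v z)
  have := norm_nonneg (fderiv ℝ u z)
  have := norm_nonneg (fderiv ℝ v z)
  gcongr <;> linarith

theorem HasLocBddDeriv.integrable_mul {u χ : (Fin n → ℂ) → ℂ} (hu : HasLocBddDeriv u)
    (hχ : Continuous χ) (hc : HasCompactSupport χ) (v : Fin n → ℂ) :
    Integrable fun z => χ z * fderiv ℝ u z v := by
  obtain ⟨R, hR⟩ := hc.isCompact.isBounded.subset_closedBall (0 : Fin n → ℂ)
  obtain ⟨C, hC⟩ := hu.2 R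
  have hi : Integrable fun z => ‖χ z‖ * (C * ‖v‖) :=
    ((hχ.integrable_of_hasCompactSupport hc).norm).mul_const _
  refine hi.mono' ?_ (ae_of_all _ fun z => ?_)
  · exact hχ.aestronglyMeasurable.mul
      (measurable_fderiv_apply_const ℝ u v).aestronglyMeasurable
  · rw [norm_mul]
    by_cases hz : z ∈ tsupport χ
    · have h1 := hC z (by simpa using hR hz)
      gcongr
      exact (ContinuousLinearMap.le_opNorm _ _).trans (by gcongr)
    · simp [image_eq_zero_of_notMem_tsupport hz]

theorem integral_mul_wirtingerBar (j : Fin n) {u χ : (Fin n → ℂ) → ℂ} (hu : HasLocBddDeriv u)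
    (hχ : ContDiff ℝ 1 χ) (hc : HasCompactSupport χ) :
    ∫ z, χ z * wirtingerBar j u z = -∫ z, wirtingerBar j χ z * u z := by
  have hi1 := fun v => hu.integrable_mul hχ.continuous hc v
  have hi2 : ∀ v, Integrable fun z => fderiv ℝ χ z v * u z := fun v =>
    Continuous.integrable_of_hasCompactSupport
      ((hχ.continuous_fderiv_apply one_ne_zero |>.comp (by fun_prop :
        Continuous fun z => ((z, v) : (Fin n → ℂ) × (Fin n → ℂ)))).mul hu.1.continuous)
      ((hc.fderiv_apply (𝕜 := ℝ) v).mul_right)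
  have key : ∀ v, ∫ z, χ z * fderiv ℝ u z v = -∫ z, fderiv ℝ χ z v * u z := fun v =>
    integral_mul_fderiv_eq_neg_fderiv_mul_of_integrable (hi2 v) (hi1 v)
      ((hχ.continuous.mul hu.1.continuous).integrable_of_hasCompactSupport hc.mul_right)
      (fun z _ => hχ.differentiable one_ne_zero z) (fun z _ => hu.1 z)
  have e1 : ∀ z, χ z * wirtingerBar j u z = (2⁻¹ : ℂ) * (χ z * fderiv ℝ u z (Pi.single j 1))
      + (2⁻¹ * Complex.I) * (χ z * fderiv ℝ u z (Pi.single j Complex.I)) := fun z => by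
    simp only [wirtingerBar]
    ring
  have e2 : ∀ z, wirtingerBar j χ z * u z = (2⁻¹ : ℂ) * (fderiv ℝ χ z (Pi.single j 1) * u z)
      + (2⁻¹ * Complex.I) * (fderiv ℝ χ z (Pi.single j Complex.I) * u z) := fun z => by
    simp only [wirtingerBar]
    ring
  simp only [e1, e2]
  rw [integral_add ((hi1 _).const_mul _) ((hi1 _).const_mul _),
    integral_add ((hi2 _).const_mul _) ((hi2 _).const_mul _)]
  simp only [integral_const_mul, key]
  ring

theorem exists_cutoff (n : ℕ) : ∃ χ : (Fin n → ℂ) → ℂ, ContDiff ℝ 1 χ ∧ HasCompactSupport χ ∧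
    (∀ z, ‖z‖ ≤ 1 → χ z = 1) ∧ ∀ z, ‖χ z‖ ≤ 1 := by
  let b : ContDiffBump (0 : Fin n → ℂ) := ⟨1, 2, one_pos, one_lt_two⟩
  refine ⟨fun z => (b z : ℂ), Complex.ofRealCLM.contDiff.comp b.contDiff, ?_, fun z hz => ?_,
    fun z => ?_⟩
  · exact b.hasCompactSupport.comp_left (g := fun x : ℝ => (x : ℂ)) Complex.ofReal_zero
  · simp only
    rw [b.one_of_mem_closedBall (by simpa using hz), Complex.ofReal_one]
  · simp only
    rw [Complex.norm_real, Real.norm_of_nonneg b.nonneg]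
    exact b.le_one

/-- Integrate by parts against the cutoff $\chi(z/(m+1))$. As $m\to\infty$ one side tends to the
wanted integral by dominated convergence, while differentiating the cutoff costs a factor $1/(m+1)$.
-/
theorem integral_wirtingerBar_eq_zero (j : Fin n) {u : (Fin n → ℂ) → ℂ} (hu : HasLocBddDeriv u)
    (h1 : Integrable u) (h2 : Integrable (wirtingerBar j u)) : ∫ z, wirtingerBar j u z = 0 := by
  obtain ⟨χ, hχ, hc, hone, hle⟩ := exists_cutoff n
  obtain ⟨D, hD⟩ := (hc.fderiv (𝕜 := ℝ)).exists_bound_of_continuous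
    (hχ.continuous_fderiv one_ne_zero)
  set c : ℕ → ℝ := fun m => 1 / ((m : ℝ) + 1) with hcdef
  have hc0 : Tendsto c atTop (𝓝 0) := tendsto_one_div_add_atTop_nhds_zero_nat
  have hcpos : ∀ m, 0 < c m := fun m => by positivity
  have hd : ∀ m z, wirtingerBar j (fun z => χ (c m • z)) z = c m * wirtingerBar j χ (c m • z) := by
    intro m z
    have : fderiv ℝ (fun z => χ (c m • z)) z = c m • fderiv ℝ χ (c m • z) := fderiv_comp_smul (c m)
    simp only [wirtingerBar, this]
    simp
    ring
  have heq : ∀ m, ∫ z, χ (c m • z) * wirtingerBar j u z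
      = -∫ z, c m * wirtingerBar j χ (c m • z) * u z := by
    intro m
    have := integral_mul_wirtingerBar j (χ := fun z => χ (c m • z)) hu
      (hχ.comp (contDiff_const_smul _)) (hc.comp_smul (hcpos m).ne')
    simpa only [hd] using this
  have hL : Tendsto (fun m => ∫ z, χ (c m • z) * wirtingerBar j u z) atTop
      (𝓝 (∫ z, wirtingerBar j u z)) := by
    refine tendsto_integral_of_dominated_convergence (fun z => ‖wirtingerBar j u z‖) (fun m => ?_)
      h2.norm (fun m => ae_of_all _ fun z => ?_) (ae_of_all _ fun z => ?_)
    · have := hχ.continuous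
      exact (Continuous.aestronglyMeasurable (by fun_prop)).mul h2.1
    · rw [norm_mul]
      exact mul_le_of_le_one_left (norm_nonneg _) (hle _)
    · have h3 : Tendsto (fun m => c m * ‖z‖) atTop (𝓝 0) := by simpa using hc0.mul_const ‖z‖
      refine tendsto_const_nhds.congr' ?_
      filter_upwards [h3.eventually_le_const one_pos] with m hm
      rw [hone _ (by rwa [norm_smul, Real.norm_of_nonneg (hcpos m).le]), one_mul]
  have hR : Tendsto (fun m => -∫ z, c m * wirtingerBar j χ (c m • z) * u z) atTop (𝓝 0) := by
    have hb : Tendsto (fun m => c m * (‖wirtingerBarL j‖ * D * ∫ z, ‖u z‖)) atTop (𝓝 0) := by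
      simpa using hc0.mul_const (‖wirtingerBarL j‖ * D * ∫ z, ‖u z‖)
    refine squeeze_zero_norm (fun m => ?_) hb
    rw [norm_neg]
    refine (norm_integral_le_integral_norm _).trans ?_
    rw [← integral_const_mul, ← integral_const_mul]
    refine integral_mono_of_nonneg (ae_of_all _ fun z => norm_nonneg _)
      ((h1.norm.const_mul _).const_mul _) (ae_of_all _ fun z => ?_)
    simp only [norm_mul, Complex.norm_real, Real.norm_of_nonneg (hcpos m).le, mul_assoc]
    refine mul_le_mul_of_nonneg_left ?_ (hcpos m).le
    rw [← mul_assoc]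
    refine mul_le_mul_of_nonneg_right ?_ (norm_nonneg _)
    rw [wirtingerBar_apply]
    refine (ContinuousLinearMap.le_opNorm _ _).trans ?_
    gcongr
    exact hD _
  simp only [heq] at hL
  exact tendsto_nhds_unique hL hR

theorem contDiff_gaussianDensity (n : ℕ) (t : ℝ) :
    ContDiff ℝ 1 fun z => (gaussianDensity n t z : ℂ) := by
  have h1 : ∀ j, ContDiff ℝ 1 fun z : Fin n → ℂ => ‖z j‖ ^ 2 := fun j =>
    (contDiff_apply ℝ ℂ j).norm_sq ℝ
  have h2 : ContDiff ℝ 1 fun z : Fin n → ℂ => ∑ j, ‖z j‖ ^ 2 := ContDiff.sum fun j _ => h1 j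
  have h3 : ContDiff ℝ 1 (gaussianDensity n t) :=
    contDiff_const.mul (h2.neg.div_const t).exp
  exact Complex.ofRealCLM.contDiff.comp h3

theorem wirtingerBar_gaussianDensity (j : Fin n) (t : ℝ) (z : Fin n → ℂ) :
    wirtingerBar j (fun z => (gaussianDensity n t z : ℂ)) z
      = -(z j / t) * (gaussianDensity n t z : ℂ) := by
  have h0 : ∀ i, HasFDerivAt (fun z : Fin n → ℂ => ‖z i‖ ^ 2) _ z := fun i =>
    ((ContinuousLinearMap.proj (R := ℝ) (φ := fun _ : Fin n => ℂ) i).hasFDerivAt (x := z)).norm_sq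
  have h1 := HasFDerivAt.fun_sum (u := Finset.univ) fun i _ => h0 i
  have h2 := ((h1.neg.mul_const t⁻¹).exp).const_mul (((Real.pi * t) ^ n)⁻¹)
  have h3 : HasFDerivAt (fun z => (gaussianDensity n t z : ℂ)) _ z :=
    Complex.ofRealCLM.hasFDerivAt.comp z h2
  have h4 : ∀ v : ℂ, fderiv ℝ (fun z => (gaussianDensity n t z : ℂ)) z (Pi.single j v)
      = ((gaussianDensity n t z * (-(2 * (inner ℝ (z j) v : ℝ)) / t) : ℝ) : ℂ) := by
    intro v
    rw [h3.fderiv]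
    simp only [gaussianDensity, div_eq_mul_inv]
    simp
    have h5 : ∑ x, (2 * (((Pi.single j v : Fin n → ℂ) x).re * ((z x).re : ℂ))
        + 2 * (((Pi.single j v : Fin n → ℂ) x).im * ((z x).im : ℂ)))
        = 2 * (v.re * (z j).re + v.im * (z j).im) := by
      rw [Finset.sum_eq_single j (fun i _ hi => by simp [Pi.single_eq_of_ne hi]) (by simp)]
      simp
      ring
    rw [h5]
    ring
  simp only [wirtingerBar, h4]
  have h5 : (z j).re + (z j).im * Complex.I = z j := Complex.re_add_im _
  simp [Complex.inner]
  linear_combination (-1 / t * (gaussianDensity n t z : ℂ)) * h5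

/-- Multiplication by `z̄_j - t ∂_j` is `t` times the adjoint of `∂̄_j` in `L²(μ_t)`. -/
theorem integral_star_multiHermite_add_single {t : ℝ} (ht : 0 < t) (α β : Fin n → ℕ) (j : Fin n)
    {u : (Fin n → ℂ) → ℂ} (hu : HasLocBddDeriv u) (h1 : MemLp u 2 (gaussianMeasure n t))
    (h2 : MemLp (wirtingerBar j u) 2 (gaussianMeasure n t)) :
    ∫ z, star (multiHermite t (α + Pi.single j 1) β z) * u z ∂gaussianMeasure n t
      = t * ∫ z, star (multiHermite t α β z) * wirtingerBar j u z ∂gaussianMeasure n t := by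
  have ht' : (t : ℂ) ≠ 0 := by exact_mod_cast ht.ne'
  have he := fun α β => (expGrowth_multiHermite t (n := n) α β).memLp ht
  have hint : ∀ α β, ∀ v : (Fin n → ℂ) → ℂ, MemLp v 2 (gaussianMeasure n t) →
      Integrable (fun z => star (multiHermite t α β z) * v z) (gaussianMeasure n t) :=
    fun α β v hv => (he α β).star.integrable_mul hv
  simp only [star_multiHermite] at hint ⊢
  have hI1 := (integrable_gaussianMeasure_iff n ht).1 (hint (α + Pi.single j 1) β u h1)
  have hI2 := (integrable_gaussianMeasure_iff n ht).1 (hint α β _ h2)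
  have hI3 := (integrable_gaussianMeasure_iff n ht).1 (hint α β u h1)
  have hφ : HasLocBddDeriv fun z => (gaussianDensity n t z : ℂ) * multiHermite t β α z :=
    (contDiff_gaussianDensity n t).hasLocBddDeriv.mul (contDiff_multiHermite t β α).hasLocBddDeriv
  -- Conjugation swaps the indices, so the test function is $e_{\beta,\alpha}$. The density
  -- contributes $-z_j/t$, and `mul_multiHermite` splits $z_je_{\beta,\alpha}$ into the raised
  -- polynomial and a lower term that cancels $\bar\partial_je_{\beta,\alpha}$. Integrating this
  -- total derivative gives the claim.
  have hd : ∀ z, wirtingerBar j (fun z => (gaussianDensity n t z : ℂ) * multiHermite t β α z * u z) z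
      = -(t : ℂ)⁻¹ * ((gaussianDensity n t z : ℂ) * (multiHermite t β (α + Pi.single j 1) z * u z))
        + (gaussianDensity n t z : ℂ) * (multiHermite t β α z * wirtingerBar j u z) := by
    intro z
    have h := mul_multiHermite t β α j z
    rw [wirtingerBar_mul j (hφ.1 z) (hu.1 z), wirtingerBar_mul j
      ((contDiff_gaussianDensity n t).differentiable one_ne_zero z)
      ((contDiff_multiHermite t β α).differentiable one_ne_zero z), wirtingerBar_multiHermite,
      wirtingerBar_gaussianDensity]
    field_simp
    linear_combination (-(gaussianDensity n t z : ℂ) * u z) * h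
  have hz := integral_wirtingerBar_eq_zero j (hφ.mul hu) (by simpa only [mul_assoc] using hI3)
    (by
      rw [funext hd]
      exact (hI1.const_mul _).add hI2)
  simp only [hd] at hz
  rw [integral_add (hI1.const_mul _) hI2, integral_const_mul] at hz
  rw [integral_gaussianMeasure n ht, integral_gaussianMeasure n ht]
  rw [← mul_right_inj' (inv_ne_zero ht'), inv_mul_cancel_left₀ ht']
  linear_combination -hz

end integrationByParts

/-! ### Orthogonality of the complex Hermite polynomials -/

section orthogonality

variable {n : ℕ} {t : ℝ}

/-- The pairing of `u` with `e_{α,β}` in `L²(μ_t)`. -/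
noncomputable def hermiteCoeff (t : ℝ) (α β : Fin n → ℕ) (u : (Fin n → ℂ) → ℂ) : ℂ :=
  ∫ z, star (multiHermite t α β z) * u z ∂gaussianMeasure n t

/-- The squared norm of `e_{α,β}` in `L²(μ_t)`. -/
noncomputable def hermiteNormSq (t : ℝ) (α β : Fin n → ℕ) : ℝ :=
  t ^ (∑ j, α j) * (∏ j, (α j).factorial : ℕ) * (t ^ (∑ j, β j) * (∏ j, (β j).factorial : ℕ))

theorem hermiteNormSq_pos (ht : 0 < t) (α β : Fin n → ℕ) : 0 < hermiteNormSq t α β := by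
  have h : ∀ γ : Fin n → ℕ, 0 < ((∏ j, (γ j).factorial : ℕ) : ℝ) := fun γ => by
    exact_mod_cast Finset.prod_pos fun j _ => (γ j).factorial_pos
  have := h α
  have := h β
  unfold hermiteNormSq
  positivity

theorem hermiteCoeff_add_single (ht : 0 < t) (α β : Fin n → ℕ) (j : Fin n)
    {u : (Fin n → ℂ) → ℂ} (hu : HasLocBddDeriv u) (h1 : MemLp u 2 (gaussianMeasure n t))
    (h2 : MemLp (wirtingerBar j u) 2 (gaussianMeasure n t)) :
    hermiteCoeff t (α + Pi.single j 1) β u = t * hermiteCoeff t α β (wirtingerBar j u) :=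
  integral_star_multiHermite_add_single ht α β j hu h1 h2

theorem memLp_multiHermite (ht : 0 < t) (α β : Fin n → ℕ) :
    MemLp (multiHermite t α β) 2 (gaussianMeasure n t) :=
  (expGrowth_multiHermite t α β).memLp ht

theorem hermiteCoeff_add_single_multiHermite (ht : 0 < t) (α β α' β' : Fin n → ℕ) (j : Fin n) :
    hermiteCoeff t (α + Pi.single j 1) β (multiHermite t α' β')
      = t * α' j * hermiteCoeff t α β (multiHermite t (α' - Pi.single j 1) β') := by
  have h := funext (wirtingerBar_multiHermite t α' β' j)
  rw [hermiteCoeff_add_single ht α β j (contDiff_multiHermite t α' β').hasLocBddDeriv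
    (memLp_multiHermite ht _ _) (by rw [h]; exact (memLp_multiHermite ht _ _).const_mul _), h,
    mul_assoc]
  simp only [hermiteCoeff, mul_left_comm _ (α' j : ℂ), integral_const_mul]

theorem star_hermiteCoeff_multiHermite (α β α' β' : Fin n → ℕ) :
    star (hermiteCoeff t α β (multiHermite t α' β')) = hermiteCoeff t α' β' (multiHermite t α β) := by
  simp only [hermiteCoeff, Complex.star_def]
  rw [← integral_conj]
  simp [mul_comm]

theorem hermiteCoeff_multiHermite_swap (α β α' β' : Fin n → ℕ) :
    hermiteCoeff t α β (multiHermite t α' β') = hermiteCoeff t β' α' (multiHermite t β α) := by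
  simp only [hermiteCoeff, star_multiHermite, mul_comm]

theorem single_one_le {α : Fin n → ℕ} {j : Fin n} (hj : α j ≠ 0) : Pi.single j 1 ≤ α := by
  intro i
  rcases eq_or_ne i j with rfl | h
  · simpa using Nat.one_le_iff_ne_zero.2 hj
  · simp [Pi.single_eq_of_ne h]

theorem exists_eq_add_single {α : Fin n → ℕ} (hα : α ≠ 0) :
    ∃ (j : Fin n) (α₀ : Fin n → ℕ), α = α₀ + Pi.single j 1 := by
  obtain ⟨j, hj⟩ := Function.ne_iff.1 hα
  exact ⟨j, α - Pi.single j 1, (tsub_add_cancel_of_le (single_one_le hj)).symm⟩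

theorem prod_factorial_add_single (α : Fin n → ℕ) (j : Fin n) :
    ∏ i, ((α + Pi.single j 1 : Fin n → ℕ) i).factorial = (α j + 1) * ∏ i, (α i).factorial := by
  rw [← Finset.mul_prod_erase _ _ (Finset.mem_univ j),
    ← Finset.mul_prod_erase _ (fun i => (α i).factorial) (Finset.mem_univ j), ← mul_assoc]
  congr 1
  · simp [Nat.factorial_succ]
  · exact Finset.prod_congr rfl fun i hi => by simp [Pi.single_eq_of_ne (Finset.ne_of_mem_erase hi)]

theorem sum_add_single (α : Fin n → ℕ) (j : Fin n) :
    ∑ i, (α + Pi.single j 1 : Fin n → ℕ) i = ∑ i, α i + 1 := by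
  simp [Finset.sum_add_distrib]

/-- Induction on $|\alpha|$: each raising operator on the left moves across as a lowering operator
on $\alpha'$, so the first indices must be used up simultaneously, with the factors $t\alpha_j'$
accumulating to $t^{|\alpha|}\alpha!$. -/
theorem hermiteCoeff_multiHermite_of_left (ht : 0 < t) (α β α' β' : Fin n → ℕ) :
    hermiteCoeff t α β (multiHermite t α' β') = if α = α' then
      (t ^ (∑ j, α j) * (∏ j, (α j).factorial : ℕ) : ℂ) * hermiteCoeff t 0 β (multiHermite t 0 β')
      else 0 := by
  induction hs : ∑ j, α j generalizing α α' with
  | zero =>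
    have hα : α = 0 := by
      ext j
      exact (Finset.sum_eq_zero_iff.1 hs) j (Finset.mem_univ j)
    subst hα
    split_ifs with h
    · subst h
      simp
    -- Conjugating the pairing lets the raising operator in $\alpha'$ act instead; it lowers the
    -- index $0$ and gives $0$.
    · obtain ⟨j, α₀, rfl⟩ := exists_eq_add_single (Ne.symm h)
      rw [← star_hermiteCoeff_multiHermite, hermiteCoeff_add_single_multiHermite ht]
      simp
  | succ s ih =>
    have hα : α ≠ 0 := by
      rintro rfl
      simp at hs
    obtain ⟨j, α₀, rfl⟩ := exists_eq_add_single hα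
    rw [sum_add_single] at hs
    rw [hermiteCoeff_add_single_multiHermite ht, ih α₀ _ (by omega)]
    by_cases hj : α' j = 0
    · rw [if_neg (c := α₀ + Pi.single j 1 = α')]
      · simp [hj]
      · rintro rfl
        simp at hj
    · have hle : Pi.single j 1 ≤ α' := single_one_le hj
      simp only [eq_tsub_iff_add_eq_of_le hle]
      split_ifs with h
      · subst h
        rw [prod_factorial_add_single]
        simp
        ring
      · simp

/-- Conjugation exchanges the two indices, so the reduction of the first index applies again to the
second and leaves the total mass $1$ of $\mu_t$. -/
theorem hermiteCoeff_multiHermite (ht : 0 < t) (α β α' β' : Fin n → ℕ) :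
    hermiteCoeff t α β (multiHermite t α' β')
      = if α = α' ∧ β = β' then (hermiteNormSq t α β : ℂ) else 0 := by
  have h0 : hermiteCoeff t (0 : Fin n → ℕ) 0 (multiHermite t 0 0) = 1 := by
    have := isProbabilityMeasure_gaussianMeasure n ht
    simp [hermiteCoeff, multiHermite_zero_left]
  rw [hermiteCoeff_multiHermite_of_left ht, hermiteCoeff_multiHermite_swap,
    hermiteCoeff_multiHermite_of_left ht, h0]
  by_cases h1 : α = α'
  · by_cases h2 : β = β'
    · subst h1 h2
      simp [hermiteNormSq]
    · simp [h1, h2, Ne.symm h2]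
  · simp [h1]

/-! ### Completeness of the complex Hermite polynomials -/

/-- Splits a real functional into complex-linear and antilinear parts, so that its powers are
polynomials in the $z_j,\bar z_j$. -/
theorem realDual_apply_eq_sum (L : StrongDual ℝ (Fin n → ℂ)) (z : Fin n → ℂ) :
    (L z : ℂ) = ∑ j, ((L (Pi.single j 1) - Complex.I * L (Pi.single j Complex.I)) / 2 * z j
      + (L (Pi.single j 1) + Complex.I * L (Pi.single j Complex.I)) / 2 * star (z j)) := by
  have h1 : z = ∑ j, ((z j).re • (Pi.single j 1 : Fin n → ℂ)
      + (z j).im • (Pi.single j Complex.I : Fin n → ℂ)) := by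
    conv_lhs => rw [← Finset.univ_sum_single z]
    refine Finset.sum_congr rfl fun j _ => ?_
    rw [← Pi.single_smul, ← Pi.single_smul, ← Pi.single_add]
    simp [Complex.re_add_im]
  conv_lhs => rw [h1]
  simp only [map_sum, map_add, map_smul, Complex.ofReal_sum]
  refine Finset.sum_congr rfl fun j _ => ?_
  have h2 := Complex.re_add_im (z j)
  have h3 : ((z j).re : ℂ) - (z j).im * Complex.I = star (z j) := by
    apply Complex.ext <;> simp
  simp only [smul_eq_mul, Complex.ofReal_add, Complex.ofReal_mul]
  linear_combination ((L (Pi.single j 1) : ℂ) - Complex.I * L (Pi.single j Complex.I)) / 2 * h2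
    + ((L (Pi.single j 1) : ℂ) + Complex.I * L (Pi.single j Complex.I)) / 2 * h3
    + (L (Pi.single j Complex.I) * (z j).im : ℂ) * Complex.I_mul_I

/-- Multiplication by $z_j$ or $\bar z_j$ preserves the span of the Hermite polynomials, so $v$ is
orthogonal to all polynomials. Keeping `α` and `β` arbitrary is what closes the induction on the
power. -/
theorem integral_linear_pow_mul (ht : 0 < t) {v : (Fin n → ℂ) → ℂ}
    (hv : MemLp v 2 (gaussianMeasure n t)) (h : ∀ α β, hermiteCoeff t α β v = 0)
    (c d : Fin n → ℂ) (m : ℕ) (α β : Fin n → ℕ) :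
    ∫ z, (∑ j, (c j * z j + d j * star (z j))) ^ m * multiHermite t α β z * v z
      ∂gaussianMeasure n t = 0 := by
  set l : (Fin n → ℂ) → ℂ := fun z => ∑ j, (c j * z j + d j * star (z j)) with hl
  -- Integrability is carried along with vanishing so that the property is stable under linear
  -- combinations.
  set Z : ((Fin n → ℂ) → ℂ) → Prop := fun w =>
    Integrable w (gaussianMeasure n t) ∧ ∫ z, w z ∂gaussianMeasure n t = 0 with hZ
  have hadd : ∀ {w₁ w₂}, Z w₁ → Z w₂ → Z fun z => w₁ z + w₂ z := fun h₁ h₂ =>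
    ⟨h₁.1.add h₂.1, by rw [integral_add h₁.1 h₂.1, h₁.2, h₂.2, add_zero]⟩
  have hmul : ∀ (a : ℂ) {w}, Z w → Z fun z => a * w z := fun a w h₁ =>
    ⟨h₁.1.const_mul a, by rw [integral_const_mul, h₁.2, mul_zero]⟩
  have hlg : ExpGrowth l := ExpGrowth.sum _ fun j _ =>
    ((ExpGrowth.const _).mul (.apply j)).add ((ExpGrowth.const _).mul (.conj (.apply j)))
  have hi : ∀ m α β, Integrable (fun z => l z ^ m * multiHermite t α β z * v z)
      (gaussianMeasure n t) := fun m α β => by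
    have h1 : ExpGrowth fun z => l z ^ m := by
      simpa using ExpGrowth.prod (Finset.range m) fun _ _ => hlg
    exact ((h1.mul (expGrowth_multiHermite t α β)).memLp ht).integrable_mul hv
  induction m generalizing α β with
  | zero => simpa [hermiteCoeff, star_multiHermite] using h β α
  | succ m ih =>
    have hZ0 : ∀ α β, Z fun z => l z ^ m * multiHermite t α β z * v z := fun α β =>
      ⟨hi m α β, ih α β⟩
    have hZj : ∀ j, Z fun z => c j * (l z ^ m * multiHermite t α (β + Pi.single j 1) z * v z
        + t * α j * (l z ^ m * multiHermite t (α - Pi.single j 1) β z * v z))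
        + d j * (l z ^ m * multiHermite t (α + Pi.single j 1) β z * v z
        + t * β j * (l z ^ m * multiHermite t α (β - Pi.single j 1) z * v z)) := fun j =>
      hadd (hmul _ (hadd (hZ0 _ _) (hmul _ (hZ0 _ _))))
        (hmul _ (hadd (hZ0 _ _) (hmul _ (hZ0 _ _))))
    have key : ∀ z, l z ^ (m + 1) * multiHermite t α β z * v z = ∑ j : Fin n,
        (c j * (l z ^ m * multiHermite t α (β + Pi.single j 1) z * v z
          + t * α j * (l z ^ m * multiHermite t (α - Pi.single j 1) β z * v z))
        + d j * (l z ^ m * multiHermite t (α + Pi.single j 1) β z * v z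
          + t * β j * (l z ^ m * multiHermite t α (β - Pi.single j 1) z * v z))) := by
      intro z
      have e : l z ^ (m + 1) * multiHermite t α β z * v z
        = (∑ j, (c j * z j + d j * star (z j))) * (l z ^ m * multiHermite t α β z * v z) := by
        simp only [hl]
        ring
      rw [e, Finset.sum_mul]
      refine Finset.sum_congr rfl fun j _ => ?_
      have h1 := mul_multiHermite t α β j z
      have h2 := star_mul_multiHermite t α β j z
      linear_combination (c j * l z ^ m * v z) * h1 + (d j * l z ^ m * v z) * h2
    rw [integral_congr_ae (ae_of_all _ key), integral_finsetSum _ fun j _ => (hZj j).1]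
    exact Finset.sum_eq_zero fun j _ => (hZj j).2

/-- Expand the exponential: each term integrates to zero, and $e^{|L z|}|v|$ dominates the series,
being a product of two $L^2(\mu_t)$ functions. Hence the Fourier transform of $v\mu_t$ vanishes. -/
theorem integral_exp_realDual_mul (ht : 0 < t) {v : (Fin n → ℂ) → ℂ}
    (hv : MemLp v 2 (gaussianMeasure n t)) (h : ∀ α β, hermiteCoeff t α β v = 0)
    (L : StrongDual ℝ (Fin n → ℂ)) :
    ∫ z, Complex.exp (L z * Complex.I) * v z ∂gaussianMeasure n t = 0 := by
  have hg : ExpGrowth fun z => (Real.exp |L z| : ℂ) := by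
    refine ⟨by fun_prop, 1, ‖L‖, zero_le_one, norm_nonneg _, fun z => ?_⟩
    rw [Complex.norm_real, Real.norm_of_nonneg (Real.exp_pos _).le, one_mul, Real.exp_le_exp]
    refine (L.le_opNorm z).trans (mul_le_mul_of_nonneg_left ?_ (norm_nonneg _))
    refine (pi_norm_le_iff_of_nonneg (Finset.sum_nonneg fun _ _ => norm_nonneg _)).2 fun j => ?_
    exact Finset.single_le_sum (f := fun j => ‖z j‖) (fun i _ => norm_nonneg _) (Finset.mem_univ j)
  have hsum : ∀ x : ℝ, HasSum (fun m : ℕ => x ^ m / m.factorial) (Real.exp x) := fun x => by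
    rw [Real.exp_eq_exp_ℝ]
    exact NormedSpace.expSeries_div_hasSum_exp x
  have hsumC : ∀ x : ℂ, HasSum (fun m : ℕ => x ^ m / m.factorial) (Complex.exp x) := fun x => by
    rw [Complex.exp_eq_exp_ℂ]
    exact NormedSpace.expSeries_div_hasSum_exp x
  have hH := hasSum_integral_of_dominated_convergence (μ := gaussianMeasure n t)
    (F := fun (m : ℕ) z => (L z * Complex.I) ^ m / m.factorial * v z)
    (f := fun z => Complex.exp (L z * Complex.I) * v z)
    (fun m z => |L z| ^ m / m.factorial * ‖v z‖) (fun m => ?_) (fun m => ae_of_all _ fun z => ?_)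
    (ae_of_all _ fun z => ((hsum _).mul_right _).summable) ?_ (ae_of_all _ fun z => ?_)
  · refine hH.unique ?_
    convert! hasSum_zero with m
    have : ∫ z, (L z : ℂ) ^ m * multiHermite t 0 0 z * v z ∂gaussianMeasure n t = 0 := by
      rw [← integral_linear_pow_mul ht hv h
        (fun j => (L (Pi.single j 1) - Complex.I * L (Pi.single j Complex.I)) / 2)
        (fun j => (L (Pi.single j 1) + Complex.I * L (Pi.single j Complex.I)) / 2) m 0 0]
      congr 1 with z
      rw [realDual_apply_eq_sum L z]
    have h1 : ∀ z, multiHermite t (0 : Fin n → ℕ) 0 z = 1 := fun z => by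
      simp [multiHermite_zero_left]
    simp only [h1, mul_one] at this
    have e : ∀ z, (L z * Complex.I) ^ m / m.factorial * v z
        = (Complex.I ^ m / m.factorial) * ((L z : ℂ) ^ m * v z) := fun z => by ring
    simp only [e, integral_const_mul, this, mul_zero]
  · exact (Continuous.aestronglyMeasurable (by fun_prop)).mul hv.1
  · simp
  · have : ∀ z, ∑' m : ℕ, |L z| ^ m / m.factorial * ‖v z‖ = Real.exp |L z| * ‖v z‖ := fun z =>
      ((hsum _).mul_right _).tsum_eq
    simp only [this]
    refine ((hg.memLp ht).integrable_mul hv).norm.congr (ae_of_all _ fun z => ?_)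
    simp [-Complex.ofReal_exp]
  · exact (hsumC _).mul_right _

/-- A real integrable function all of whose Fourier coefficients vanish is zero. -/
theorem ae_eq_zero_of_integral_exp_realDual_mul {E : Type*} [NormedAddCommGroup E]
    [NormedSpace ℝ E] [CompleteSpace E] [SecondCountableTopology E] [MeasurableSpace E]
    [BorelSpace E] {μ : Measure E} [IsFiniteMeasure μ] {r : E → ℝ} (hr : Integrable r μ)
    (h : ∀ L : StrongDual ℝ E, ∫ z, Complex.exp (L z * Complex.I) * r z ∂μ = 0) :
    r =ᵐ[μ] 0 := by
  have hfin : ∀ s : E → ℝ, Integrable s μ →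
      IsFiniteMeasure (μ.withDensity fun z => ENNReal.ofReal (s z)) := fun s hs =>
    isFiniteMeasure_withDensity_ofReal hs.2
  have := hfin r hr
  have := hfin (-r) hr.neg
  have hm : ∀ s : E → ℝ, Integrable s μ → AEMeasurable (fun z => ENNReal.ofReal (s z)) μ :=
    fun s hs => hs.1.aemeasurable.ennreal_ofReal
  have hchar : ∀ s : E → ℝ, Integrable s μ → ∀ L : StrongDual ℝ E,
      charFunDual (μ.withDensity fun z => ENNReal.ofReal (s z)) L
        = ∫ z, Complex.exp (L z * Complex.I) * (max (s z) 0 : ℝ) ∂μ := fun s hs L => by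
    rw [charFunDual_apply, integral_withDensity_eq_integral_toReal_smul₀ (hm s hs)
      (ae_of_all _ fun _ => ENNReal.ofReal_lt_top)]
    congr 1 with z
    rw [ENNReal.toReal_ofReal', Complex.real_smul, mul_comm]
  have hint : ∀ s : E → ℝ, Integrable s μ → ∀ L : StrongDual ℝ E,
      Integrable (fun z => Complex.exp (L z * Complex.I) * (max (s z) 0 : ℝ)) μ := fun s hs L => by
    refine Integrable.bdd_mul (c := 1) hs.pos_part.ofReal
      (Continuous.aestronglyMeasurable (by fun_prop)) (ae_of_all _ fun z => ?_)
    rw [Complex.norm_exp_ofReal_mul_I]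
  -- The positive and negative parts of `r` are densities of finite measures whose characteristic
  -- functionals agree by `h`.
  have heq : (μ.withDensity fun z => ENNReal.ofReal (r z))
      = μ.withDensity fun z => ENNReal.ofReal ((-r) z) := by
    refine Measure.ext_of_charFunDual (funext fun L => ?_)
    rw [hchar r hr, hchar (-r) hr.neg, ← sub_eq_zero, ← integral_sub (hint r hr L)
      (hint (-r) hr.neg L), ← h L]
    congr 1 with z
    rw [← mul_sub, ← Complex.ofReal_sub]
    congr 2
    simp only [Pi.neg_apply]
    exact max_zero_sub_max_neg_zero_eq_self (r z)
  have hae := (withDensity_eq_iff (hm r hr) (hm (-r) hr.neg)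
    (by
      have := measure_lt_top (μ.withDensity fun z => ENNReal.ofReal (r z)) Set.univ
      rw [withDensity_apply _ MeasurableSet.univ, Measure.restrict_univ] at this
      exact this.ne)).1 heq
  filter_upwards [hae] with z hz
  simp only [Pi.neg_apply] at hz
  rcases le_total (r z) 0 with h0 | h0
  · rw [ENNReal.ofReal_of_nonpos h0, eq_comm, ENNReal.ofReal_eq_zero] at hz
    exact le_antisymm h0 (neg_nonpos.1 hz)
  · rw [ENNReal.ofReal_of_nonpos (neg_nonpos.2 h0), ENNReal.ofReal_eq_zero] at hz
    exact le_antisymm hz h0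

theorem ae_eq_zero_of_hermiteCoeff (ht : 0 < t) {v : (Fin n → ℂ) → ℂ}
    (hv : MemLp v 2 (gaussianMeasure n t)) (h : ∀ α β, hermiteCoeff t α β v = 0) :
    v =ᵐ[gaussianMeasure n t] 0 := by
  have := isProbabilityMeasure_gaussianMeasure n ht
  have hE := integral_exp_realDual_mul ht hv h
  have hvi : Integrable v (gaussianMeasure n t) := hv.integrable one_le_two
  have hint : ∀ w : (Fin n → ℂ) → ℂ, Integrable w (gaussianMeasure n t) →
      ∀ L : StrongDual ℝ (Fin n → ℂ),
      Integrable (fun z => Complex.exp (L z * Complex.I) * w z) (gaussianMeasure n t) := by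
    intro w hw L
    refine Integrable.bdd_mul (c := 1) hw
      (Continuous.aestronglyMeasurable (by fun_prop)) (ae_of_all _ fun z => ?_)
    rw [Complex.norm_exp_ofReal_mul_I]
  -- Conjugating the identity for $-L$ gives the one for $\bar v$, so the real and imaginary parts
  -- of $v$ can be treated separately.
  have hEs : ∀ L : StrongDual ℝ (Fin n → ℂ),
      ∫ z, Complex.exp (L z * Complex.I) * star (v z) ∂gaussianMeasure n t = 0 := fun L => by
    have := congrArg star (hE (-L))
    rw [Complex.star_def, ← integral_conj, map_zero] at this
    rw [← this]
    congr 1 with z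
    simp [← Complex.exp_conj]
  have hvs : Integrable (fun z => star (v z)) (gaussianMeasure n t) :=
    hv.star.integrable one_le_two
  have hre : (fun z => (v z).re) =ᵐ[gaussianMeasure n t] 0 := by
    refine ae_eq_zero_of_integral_exp_realDual_mul hvi.re fun L => ?_
    have e : ∀ z, Complex.exp (L z * Complex.I) * ((v z).re : ℂ)
        = 2⁻¹ * (Complex.exp (L z * Complex.I) * v z)
          + 2⁻¹ * (Complex.exp (L z * Complex.I) * star (v z)) := fun z => by
      rw [Complex.re_eq_add_conj, Complex.star_def]
      ring
    simp only [e]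
    rw [integral_add ((hint v hvi L).const_mul _) ((hint _ hvs L).const_mul _),
      integral_const_mul, integral_const_mul, hE, hEs]
    simp
  have him : (fun z => (v z).im) =ᵐ[gaussianMeasure n t] 0 := by
    refine ae_eq_zero_of_integral_exp_realDual_mul hvi.im fun L => ?_
    have e : ∀ z, Complex.exp (L z * Complex.I) * ((v z).im : ℂ)
        = (2 * Complex.I)⁻¹ * (Complex.exp (L z * Complex.I) * v z)
          - (2 * Complex.I)⁻¹ * (Complex.exp (L z * Complex.I) * star (v z)) := fun z => by
      rw [Complex.im_eq_sub_conj, Complex.star_def]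
      ring
    simp only [e]
    rw [integral_sub ((hint v hvi L).const_mul _) ((hint _ hvs L).const_mul _),
      integral_const_mul, integral_const_mul, hE, hEs]
    simp
  filter_upwards [hre, him] with z h1 h2
  exact Complex.ext h1 h2

end orthogonality

/-! ### The orthonormal basis of complex Hermite polynomials -/

section basis

variable {n : ℕ} {t : ℝ}

/-- `e_{α,β}` as an element of `L²(μ_t)`. -/
noncomputable def hermiteLp (ht : 0 < t) (α β : Fin n → ℕ) : Lp ℂ 2 (gaussianMeasure n t) :=
  (memLp_multiHermite ht α β).toLp

theorem hermiteCoeff_congr {u v : (Fin n → ℂ) → ℂ} (h : u =ᵐ[gaussianMeasure n t] v)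
    (α β : Fin n → ℕ) : hermiteCoeff t α β u = hermiteCoeff t α β v :=
  integral_congr_ae (h.mono fun z hz => by simp only [hz])

theorem inner_hermiteLp (ht : 0 < t) (α β : Fin n → ℕ) (u : Lp ℂ 2 (gaussianMeasure n t)) :
    inner ℂ (hermiteLp ht α β) u = hermiteCoeff t α β u := by
  rw [L2.inner_def]
  refine integral_congr_ae ?_
  filter_upwards [(memLp_multiHermite ht α β).coeFn_toLp] with z hz
  rw [hermiteLp, hz]
  simp [mul_comm]

theorem inner_hermiteLp_hermiteLp (ht : 0 < t) (α β α' β' : Fin n → ℕ) :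
    inner ℂ (hermiteLp ht α β) (hermiteLp ht α' β')
      = if α = α' ∧ β = β' then (hermiteNormSq t α β : ℂ) else 0 := by
  rw [inner_hermiteLp, ← hermiteCoeff_multiHermite ht]
  exact hermiteCoeff_congr (memLp_multiHermite ht α' β').coeFn_toLp α β

/-- The orthonormal family `e_{α,β} / ‖e_{α,β}‖`. -/
noncomputable def hermiteUnit (ht : 0 < t) (i : (Fin n → ℕ) × (Fin n → ℕ)) :
    Lp ℂ 2 (gaussianMeasure n t) :=
  ((√(hermiteNormSq t i.1 i.2))⁻¹ : ℂ) • hermiteLp ht i.1 i.2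

theorem orthonormal_hermiteUnit (ht : 0 < t) : Orthonormal ℂ (hermiteUnit (n := n) ht) := by
  classical
  rw [orthonormal_iff_ite]
  rintro ⟨α, β⟩ ⟨α', β'⟩
  simp only [hermiteUnit, inner_smul_left, inner_smul_right, inner_hermiteLp_hermiteLp, Prod.mk.injEq]
  split_ifs with h
  · obtain ⟨rfl, rfl⟩ := h
    have h1 := hermiteNormSq_pos ht α β
    have h2 : (√(hermiteNormSq t α β) : ℂ) ≠ 0 := by exact_mod_cast (Real.sqrt_pos.2 h1).ne'
    have h3 : (√(hermiteNormSq t α β) : ℂ) * √(hermiteNormSq t α β) = hermiteNormSq t α β := by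
      exact_mod_cast Real.mul_self_sqrt h1.le
    rw [← Complex.ofReal_inv, Complex.conj_ofReal, Complex.ofReal_inv]
    field_simp
    rw [← h3]
    ring
  · simp

theorem inner_hermiteUnit (ht : 0 < t) (i : (Fin n → ℕ) × (Fin n → ℕ))
    (u : Lp ℂ 2 (gaussianMeasure n t)) : inner ℂ (hermiteUnit ht i) u
      = ((√(hermiteNormSq t i.1 i.2))⁻¹ : ℂ) * hermiteCoeff t i.1 i.2 u := by
  rw [hermiteUnit, inner_smul_left, inner_hermiteLp, ← Complex.ofReal_inv, Complex.conj_ofReal]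

/-- The Hilbert basis of `L²(μ_t)` consisting of normalized complex Hermite polynomials. -/
noncomputable def hermiteBasis (ht : 0 < t) :
    HilbertBasis ((Fin n → ℕ) × (Fin n → ℕ)) ℂ (Lp ℂ 2 (gaussianMeasure n t)) :=
  HilbertBasis.mkOfOrthogonalEqBot (orthonormal_hermiteUnit ht) (by
    rw [Submodule.eq_bot_iff]
    intro u hu
    rw [Submodule.mem_orthogonal] at hu
    rw [Lp.eq_zero_iff_ae_eq_zero]
    refine ae_eq_zero_of_hermiteCoeff ht (Lp.memLp u) fun α β => ?_
    have h := hu _ (Submodule.subset_span ⟨(α, β), rfl⟩)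
    rw [inner_hermiteUnit] at h
    have h2 : (√(hermiteNormSq t α β) : ℂ) ≠ 0 := by
      exact_mod_cast (Real.sqrt_pos.2 (hermiteNormSq_pos ht α β)).ne'
    exact (mul_eq_zero.1 h).resolve_left (inv_ne_zero h2))

theorem hermiteBasis_apply (ht : 0 < t) (i : (Fin n → ℕ) × (Fin n → ℕ)) :
    hermiteBasis ht i = hermiteUnit ht i := by
  rw [hermiteBasis, HilbertBasis.coe_mkOfOrthogonalEqBot]

theorem ofReal_sqrt_inv_mul_self {x : ℝ} (hx : 0 ≤ x) : ((√x : ℝ) : ℂ)⁻¹ * ((√x : ℝ) : ℂ)⁻¹ = (x : ℂ)⁻¹ := by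
  rw [← mul_inv]
  congr 1
  exact_mod_cast Real.mul_self_sqrt hx

/-- Parseval's identity in the unnormalized coefficients, which obey the cleaner shift rule under
$\bar\partial^\gamma$. -/
theorem hasSum_hermiteCoeff (ht : 0 < t) (u v : Lp ℂ 2 (gaussianMeasure n t)) :
    HasSum (fun i : (Fin n → ℕ) × (Fin n → ℕ) => star (hermiteCoeff t i.1 i.2 u) *
      hermiteCoeff t i.1 i.2 v / hermiteNormSq t i.1 i.2) (inner ℂ u v) := by
  have h := (hermiteBasis ht).hasSum_inner_mul_inner u v
  convert! h using 2 with i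
  rw [hermiteBasis_apply, ← inner_conj_symm, inner_hermiteUnit, inner_hermiteUnit, map_mul,
    ← Complex.ofReal_inv, Complex.conj_ofReal, Complex.ofReal_inv, Complex.star_def]
  have := ofReal_sqrt_inv_mul_self (hermiteNormSq_pos ht i.1 i.2).le
  linear_combination (-(starRingEnd ℂ) (hermiteCoeff t i.1 i.2 u) * hermiteCoeff t i.1 i.2 v) * this

theorem hasSum_norm_hermiteCoeff_sq (ht : 0 < t) (u : Lp ℂ 2 (gaussianMeasure n t)) :
    HasSum (fun i : (Fin n → ℕ) × (Fin n → ℕ) => ‖hermiteCoeff t i.1 i.2 u‖ ^ 2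
      / hermiteNormSq t i.1 i.2) (‖u‖ ^ 2) := by
  have h := hasSum_hermiteCoeff ht u u
  rw [inner_self_eq_norm_sq_to_K] at h
  rw [← Complex.hasSum_ofReal]
  convert! h using 2 with i
  · rw [Complex.star_def, Complex.conj_mul']
    push_cast
    rfl
  · simp

/-- Cauchy-Schwarz for the moduli of the normalized coefficients. Absolute values are needed because
the remainder is estimated term by term. -/
theorem sum_norm_hermiteCoeff_mul_le (ht : 0 < t) (u v : Lp ℂ 2 (gaussianMeasure n t)) :
    (Summable fun i : (Fin n → ℕ) × (Fin n → ℕ) => ‖hermiteCoeff t i.1 i.2 u‖ *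
      ‖hermiteCoeff t i.1 i.2 v‖ / hermiteNormSq t i.1 i.2) ∧
    ∑' i : (Fin n → ℕ) × (Fin n → ℕ), ‖hermiteCoeff t i.1 i.2 u‖ *
      ‖hermiteCoeff t i.1 i.2 v‖ / hermiteNormSq t i.1 i.2 ≤ ‖u‖ * ‖v‖ := by
  have e : ∀ w : Lp ℂ 2 (gaussianMeasure n t), HasSum (fun i : (Fin n → ℕ) × (Fin n → ℕ) =>
      (‖hermiteCoeff t i.1 i.2 w‖ / √(hermiteNormSq t i.1 i.2)) ^ (2 : ℝ)) (‖w‖ ^ (2 : ℝ)) := by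
    intro w
    have h := hasSum_norm_hermiteCoeff_sq ht w
    simp only [Real.rpow_two, div_pow]
    convert! h using 3 with i
    exact Real.sq_sqrt (hermiteNormSq_pos ht i.1 i.2).le
  obtain ⟨C, -, hCle, hC⟩ := Real.inner_le_Lp_mul_Lq_hasSum_of_nonneg
    (Real.holderConjugate_iff.2 ⟨one_lt_two, by norm_num⟩) (norm_nonneg u) (norm_nonneg v)
    (fun i => by positivity) (fun i => by positivity) (e u) (e v)
  have hC' : HasSum (fun i : (Fin n → ℕ) × (Fin n → ℕ) => ‖hermiteCoeff t i.1 i.2 u‖ *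
      ‖hermiteCoeff t i.1 i.2 v‖ / hermiteNormSq t i.1 i.2) C := by
    convert! hC using 2 with i
    rw [div_mul_div_comm, Real.mul_self_sqrt (hermiteNormSq_pos ht i.1 i.2).le]
  exact ⟨hC'.summable, hC'.tsum_eq.trans_le hCle⟩

theorem hermiteLp_zero_mem_fockSpace (ht : 0 < t) (β : Fin n → ℕ) :
    hermiteLp ht 0 β ∈ fockSpace n t := by
  refine ⟨multiHermite t 0 β, ?_, (memLp_multiHermite ht 0 β).coeFn_toLp⟩
  simp only [funext (multiHermite_zero_left t β)]
  fun_prop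

end basis

/-! ### Functions with bounded derivatives -/

section IsCb

variable {n : ℕ}

theorem IsCb.mono {m m' : ℕ} {f : (Fin n → ℂ) → ℂ} (hf : IsCb m f) (h : m' ≤ m) : IsCb m' f :=
  ⟨hf.1.of_le (by exact_mod_cast h), fun i hi => hf.2 i (hi.trans h)⟩

theorem IsCb.exists_bound {m : ℕ} {f : (Fin n → ℂ) → ℂ} (hf : IsCb m f) :
    ∃ C, 0 ≤ C ∧ ∀ z, ‖f z‖ ≤ C := by
  obtain ⟨C, hC⟩ := hf.2 0 (Nat.zero_le _)
  exact ⟨C, (norm_nonneg _).trans (hC 0), fun z => by simpa using hC z⟩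

theorem IsCb.wirtingerBar {m : ℕ} {f : (Fin n → ℂ) → ℂ} (hf : IsCb (m + 1) f) (j : Fin n) :
    IsCb m (wirtingerBar j f) := by
  have h1 : FockToeplitz.wirtingerBar j f = wirtingerBarL j ∘ fderiv ℝ f :=
    funext fun z => wirtingerBar_apply j f z
  have h2 : ContDiff ℝ m (fderiv ℝ f) := hf.1.fderiv_right (by norm_cast)
  rw [h1]
  refine ⟨(wirtingerBarL j).contDiff.comp h2, fun i hi => ?_⟩
  obtain ⟨C, hC⟩ := hf.2 (i + 1) (by omega)
  refine ⟨‖wirtingerBarL j‖ * C, fun z => ?_⟩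
  refine (ContinuousLinearMap.norm_iteratedFDeriv_comp_left (wirtingerBarL j) h2.contDiffAt
    (by exact_mod_cast hi)).trans ?_
  rw [norm_iteratedFDeriv_fderiv]
  gcongr
  exact hC z

theorem IsCb.star {m : ℕ} {f : (Fin n → ℂ) → ℂ} (hf : IsCb m f) :
    IsCb m fun z => star (f z) := by
  refine ⟨Complex.conjCLE.contDiff.comp hf.1, fun i hi => ?_⟩
  obtain ⟨C, hC⟩ := hf.2 i hi
  refine ⟨C, fun z => ?_⟩
  have := Complex.conjLIE.norm_iteratedFDeriv_comp_left f z i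
  exact this.trans_le (hC z)

theorem IsCb.iterate_wirtingerBar {m c : ℕ} {f : (Fin n → ℂ) → ℂ} (hf : IsCb (m + c) f)
    (j : Fin n) : IsCb m ((FockToeplitz.wirtingerBar j)^[c] f) := by
  induction c generalizing f with
  | zero => simpa using hf
  | succ c ih =>
    rw [Function.iterate_succ_apply]
    exact ih (hf.wirtingerBar j)

theorem IsCb.foldr_wirtingerBar (γ : Fin n → ℕ) (l : List (Fin n)) {m : ℕ} {f : (Fin n → ℂ) → ℂ}
    (hf : IsCb (m + (l.map γ).sum) f) :
    IsCb m (l.foldr (fun j h => (FockToeplitz.wirtingerBar j)^[γ j] h) f) := by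
  induction l generalizing m with
  | nil => simpa using hf
  | cons j l ih =>
    rw [List.foldr_cons]
    refine IsCb.iterate_wirtingerBar (ih ?_) j
    rw [List.map_cons, List.sum_cons] at hf
    rwa [add_assoc]

theorem sum_map_finRange (γ : Fin n → ℕ) : ((List.finRange n).map γ).sum = ∑ j, γ j := by
  rw [← List.ofFn_eq_map, List.sum_ofFn]

theorem IsCb.wirtingerBarPow {m : ℕ} {f : (Fin n → ℂ) → ℂ} (γ : Fin n → ℕ)
    (hf : IsCb (m + ∑ j, γ j) f) : IsCb m (wirtingerBarPow γ f) :=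
  IsCb.foldr_wirtingerBar γ _ (by rwa [sum_map_finRange])

/-- Turns derivatives $\partial^\gamma f$ into $\bar\partial^\gamma\bar f$, so that both symbols are
handled by the $\bar\partial$ calculus. -/
theorem wirtingerBarPow_star (γ : Fin n → ℕ) (f : (Fin n → ℂ) → ℂ) :
    wirtingerBarPow γ (fun z => star (f z)) = fun z => star (wirtingerPow γ f z) := by
  unfold wirtingerBarPow wirtingerPow
  have h1 : ∀ j (f : (Fin n → ℂ) → ℂ), FockToeplitz.wirtingerBar j (fun z => star (f z))
      = fun z => star (wirtinger j f z) := fun j f => funext fun z => wirtingerBar_star j f z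
  have h2 : ∀ c j (f : (Fin n → ℂ) → ℂ), (FockToeplitz.wirtingerBar j)^[c] (fun z => star (f z))
      = fun z => star ((wirtinger j)^[c] f z) := by
    intro c j
    induction c with
    | zero => exact fun f => rfl
    | succ c ih =>
      intro f
      rw [Function.iterate_succ_apply, Function.iterate_succ_apply, h1, ih]
  induction List.finRange n with
  | nil => rfl
  | cons j l ih => rw [List.foldr_cons, List.foldr_cons, ih, h2]

variable {t : ℝ}

theorem IsCb.memLp_mul {m : ℕ} {g F : (Fin n → ℂ) → ℂ} (hg : IsCb m g)
    (hF : MemLp F 2 (gaussianMeasure n t)) :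
    MemLp (fun z => g z * F z) 2 (gaussianMeasure n t) := by
  obtain ⟨C, -, hC⟩ := hg.exists_bound
  refine hF.of_le_mul (c := C) (hg.1.continuous.aestronglyMeasurable.mul hF.1)
    (ae_of_all _ fun z => ?_)
  rw [norm_mul]
  exact mul_le_mul_of_nonneg_right (hC z) (norm_nonneg _)

/-- Since $\bar\partial_jF=0$, the product rule leaves the derivative on the bounded symbol only. -/
theorem hermiteCoeff_add_single_mul (ht : 0 < t) {g F : (Fin n → ℂ) → ℂ} (hg : IsCb 1 g)
    (hF : Differentiable ℂ F) (hF2 : MemLp F 2 (gaussianMeasure n t)) (α β : Fin n → ℕ)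
    (j : Fin n) : hermiteCoeff t (α + Pi.single j 1) β (fun z => g z * F z)
      = t * hermiteCoeff t α β (fun z => wirtingerBar j g z * F z) := by
  have hgd : ContDiff ℝ 1 g := by simpa using hg.1
  have h : wirtingerBar j (fun z => g z * F z) = fun z => wirtingerBar j g z * F z := by
    funext z
    rw [wirtingerBar_mul j (hgd.differentiable one_ne_zero z) (hF.restrictScalars ℝ z),
      hF.wirtingerBar_eq_zero, mul_zero, add_zero]
  rw [hermiteCoeff_add_single ht α β j (hgd.hasLocBddDeriv.mul hF.hasLocBddDeriv)
    (hg.memLp_mul hF2) (by rw [h]; exact (IsCb.wirtingerBar (m := 0) hg j).memLp_mul hF2), h]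

theorem hermiteCoeff_add_smul_single_mul (ht : 0 < t) {F : (Fin n → ℂ) → ℂ}
    (hF : Differentiable ℂ F) (hF2 : MemLp F 2 (gaussianMeasure n t)) (α β : Fin n → ℕ)
    (j : Fin n) {c : ℕ} {g : (Fin n → ℂ) → ℂ} (hg : IsCb c g) :
    hermiteCoeff t (α + Pi.single j c) β (fun z => g z * F z)
      = t ^ c * hermiteCoeff t α β (fun z => (wirtingerBar j)^[c] g z * F z) := by
  induction c generalizing g with
  | zero => simp
  | succ c ih =>
    rw [Pi.single_add, ← add_assoc, hermiteCoeff_add_single_mul ht (hg.mono (by omega)) hF hF2,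
      ih (hg.wirtingerBar j), Function.iterate_succ_apply]
    ring

/-- The tail of the list is peeled off before its head, matching the nesting of derivatives in
`wirtingerBarPow`; no commutation of derivatives is needed. -/
theorem hermiteCoeff_add_list_sum_mul (ht : 0 < t) {F : (Fin n → ℂ) → ℂ}
    (hF : Differentiable ℂ F) (hF2 : MemLp F 2 (gaussianMeasure n t)) (α β γ : Fin n → ℕ)
    (l : List (Fin n)) {g : (Fin n → ℂ) → ℂ} (hg : IsCb (l.map γ).sum g) :
    hermiteCoeff t (α + (l.map fun j => Pi.single j (γ j)).sum) β (fun z => g z * F z)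
      = t ^ (l.map γ).sum * hermiteCoeff t α β
        (fun z => l.foldr (fun j h => (wirtingerBar j)^[γ j] h) g z * F z) := by
  induction l generalizing α with
  | nil => simp
  | cons j l ih =>
    rw [List.map_cons, List.sum_cons] at hg
    rw [List.map_cons, List.sum_cons, ← add_assoc, ih _ (hg.mono (by omega)),
      hermiteCoeff_add_smul_single_mul ht hF hF2 α β j (hg.foldr_wirtingerBar γ l), List.map_cons,
      List.sum_cons, List.foldr_cons]
    ring

theorem hermiteCoeff_add_mul (ht : 0 < t) {g F : (Fin n → ℂ) → ℂ} (α β γ : Fin n → ℕ)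
    (hg : IsCb (∑ j, γ j) g) (hF : Differentiable ℂ F) (hF2 : MemLp F 2 (gaussianMeasure n t)) :
    hermiteCoeff t (α + γ) β (fun z => g z * F z)
      = t ^ (∑ j, γ j) * hermiteCoeff t α β (fun z => wirtingerBarPow γ g z * F z) := by
  have h := hermiteCoeff_add_list_sum_mul ht hF hF2 α β γ (List.finRange n) (g := g)
    (by rwa [sum_map_finRange])
  rw [sum_map_finRange, ← List.ofFn_eq_map, List.sum_ofFn, Finset.univ_sum_single] at h
  exact h

/-- Some raising operator in $e_{\alpha,\beta}$ moves over to $F$ as $\bar\partial_j$, which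
annihilates it. -/
theorem hermiteCoeff_eq_zero_of_ne_zero (ht : 0 < t) {F : (Fin n → ℂ) → ℂ} {α : Fin n → ℕ}
    (hα : α ≠ 0) (β : Fin n → ℕ) (hF : Differentiable ℂ F)
    (hF2 : MemLp F 2 (gaussianMeasure n t)) : hermiteCoeff t α β F = 0 := by
  obtain ⟨j, α₀, rfl⟩ := exists_eq_add_single hα
  have h : wirtingerBar j F = 0 := funext fun z => hF.wirtingerBar_eq_zero j z
  rw [hermiteCoeff_add_single ht α₀ β j hF.hasLocBddDeriv hF2 (by rw [h]; exact MemLp.zero), h]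
  simp [hermiteCoeff]

end IsCb

/-! ### Binomial coefficients of multi-indices -/

/-- The binomial coefficient `∏ j, (α_j choose γ_j)` of two multi-indices. -/
def multiChoose {n : ℕ} (α γ : Fin n → ℕ) : ℕ := ∏ j, (α j).choose (γ j)

/-- Vandermonde's convolution, iterated over the coordinates; it reduces multi-index
inclusion-exclusion to the integer $|\alpha|$. -/
theorem sum_piAntidiag_prod_choose {ι : Type*} [DecidableEq ι] (s : Finset ι) (α : ι → ℕ) (m : ℕ) :
    ∑ γ ∈ s.piAntidiag m, ∏ j ∈ s, (α j).choose (γ j) = (∑ j ∈ s, α j).choose m := by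
  induction s using Finset.cons_induction generalizing m with
  | empty =>
    rcases m with _ | m
    · simp
    · simp
  | cons i s hi ih =>
    rw [Finset.piAntidiag_cons hi, Finset.sum_disjiUnion, Finset.sum_cons, Nat.add_choose_eq]
    refine Finset.sum_congr rfl fun p _ => ?_
    rw [Finset.sum_map, ← ih, Finset.mul_sum]
    refine Finset.sum_congr rfl fun γ hγ => ?_
    have h0 : γ i = 0 := by
      by_contra h
      exact hi ((Finset.mem_piAntidiag.1 hγ).2 i h)
    rw [Finset.prod_cons]
    congr 1
    · simp [h0]
    · refine Finset.prod_congr rfl fun j hj => ?_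
      have : j ≠ i := fun h => hi (h ▸ hj)
      simp [this]

theorem sum_multiIndices {M : Type*} [AddCommMonoid M] (n k : ℕ) (φ : (Fin n → ℕ) → M) :
    ∑ γ ∈ multiIndices n k, φ γ
      = ∑ m ∈ Finset.range (k + 1), ∑ γ ∈ Finset.univ.piAntidiag m, φ γ := by
  rw [← Finset.sum_fiberwise_of_maps_to (s := multiIndices n k) (t := Finset.range (k + 1))
    (g := fun γ => ∑ j, γ j) fun γ hγ => by
      rw [mem_multiIndices] at hγ
      simpa using Nat.lt_succ_of_le hγ]
  refine Finset.sum_congr rfl fun m hm => Finset.sum_congr ?_ fun _ _ => rfl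
  ext γ
  simp only [Finset.mem_filter, mem_multiIndices, Finset.mem_piAntidiag, Finset.mem_range] at hm ⊢
  simp
  omega

/-- For $N\ge1$ the truncated alternating sum telescopes to $(-1)^k\binom{N-1}{k}$, and Pascal's
rule gives $\binom{N-1}{k}\le\binom{N}{k+1}$. For $N=0$ the left side is zero. -/
theorem abs_alternating_sum_range_choose_le (N k : ℕ) :
    |(if N = 0 then 1 else 0 : ℤ) - ∑ m ∈ Finset.range (k + 1), (-1) ^ m * (N.choose m : ℤ)|
      ≤ N.choose (k + 1) := by
  rcases N with _ | N
  · rw [Finset.sum_range_succ']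
    simp
  · rw [Int.alternating_sum_range_choose_eq_choose, if_neg (Nat.succ_ne_zero N), zero_sub, abs_neg,
      abs_mul, abs_pow, abs_neg, abs_one, one_pow, one_mul, Nat.abs_cast, Nat.choose_succ_succ]
    push_cast
    linarith [(N.choose (k + 1)).cast_nonneg (α := ℤ)]

theorem abs_alternating_sum_multiChoose_le {n : ℕ} (k : ℕ) (α : Fin n → ℕ) :
    |(if α = 0 then 1 else 0 : ℤ)
        - ∑ γ ∈ multiIndices n k, (-1) ^ (∑ j, γ j) * (multiChoose α γ : ℤ)|
      ≤ ∑ γ ∈ Finset.univ.piAntidiag (k + 1), (multiChoose α γ : ℤ) := by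
  have h1 : ∀ m, ∑ γ ∈ Finset.univ.piAntidiag m, (multiChoose α γ : ℤ)
      = (∑ j, α j).choose m := fun m => by
    rw [← sum_piAntidiag_prod_choose]
    simp [multiChoose]
  have h2 : ∑ γ ∈ multiIndices n k, (-1) ^ (∑ j, γ j) * (multiChoose α γ : ℤ)
      = ∑ m ∈ Finset.range (k + 1), (-1) ^ m * ((∑ j, α j).choose m : ℤ) := by
    rw [sum_multiIndices]
    refine Finset.sum_congr rfl fun m _ => ?_
    rw [← h1, Finset.mul_sum]
    refine Finset.sum_congr rfl fun γ hγ => ?_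
    rw [(Finset.mem_piAntidiag.1 hγ).1]
  have h3 : α = 0 ↔ ∑ j, α j = 0 := by
    simp [funext_iff]
  simp only [h1, h2, h3]
  exact abs_alternating_sum_range_choose_le _ _

theorem multiChoose_add_mul_factorial {n : ℕ} (α γ : Fin n → ℕ) :
    multiChoose (α + γ) γ * ((∏ j, (γ j).factorial) * ∏ j, (α j).factorial)
      = ∏ j, ((α + γ : Fin n → ℕ) j).factorial := by
  rw [multiChoose, ← Finset.prod_mul_distrib, ← Finset.prod_mul_distrib]
  refine Finset.prod_congr rfl fun j _ => ?_
  rw [Pi.add_apply, ← mul_assoc]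
  simpa using Nat.choose_mul_factorial_mul_factorial (Nat.le_add_left (γ j) (α j))

theorem multiChoose_eq_zero {n : ℕ} {α γ : Fin n → ℕ} (h : ¬γ ≤ α) : multiChoose α γ = 0 := by
  obtain ⟨j, hj⟩ := not_forall.1 h
  exact Finset.prod_eq_zero (Finset.mem_univ j) (Nat.choose_eq_zero_of_lt (not_le.1 hj))

theorem hermiteNormSq_add {n : ℕ} (t : ℝ) (α β γ : Fin n → ℕ) :
    hermiteNormSq t (α + γ) β = t ^ (∑ j, γ j) * multiChoose (α + γ) γ *
      (∏ j, (γ j).factorial : ℕ) * hermiteNormSq t α β := by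
  have h := multiChoose_add_mul_factorial α γ
  have h' : ((∏ j, ((α + γ : Fin n → ℕ) j).factorial : ℕ) : ℝ)
      = multiChoose (α + γ) γ * ((∏ j, (γ j).factorial : ℕ) * (∏ j, (α j).factorial : ℕ)) := by
    rw [← h]
    push_cast
    ring
  rw [hermiteNormSq, hermiteNormSq, h']
  simp only [Pi.add_apply, Finset.sum_add_distrib, pow_add]
  ring

/-! ### Toeplitz operators in terms of Hermite coefficients -/

section shift

variable {n : ℕ} {t : ℝ}

theorem add_prod_injective (γ : Fin n → ℕ) : Function.Injective
    fun i : (Fin n → ℕ) × (Fin n → ℕ) => (i.1 + γ, i.2) := by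
  rintro ⟨α, β⟩ ⟨α', β'⟩ h
  simp only [Prod.mk.injEq, add_left_inj] at h
  exact Prod.ext h.1 h.2

theorem multiChoose_eq_zero_of_notMem_range {γ : Fin n → ℕ} {i : (Fin n → ℕ) × (Fin n → ℕ)}
    (hi : i ∉ Set.range fun i : (Fin n → ℕ) × (Fin n → ℕ) => (i.1 + γ, i.2)) :
    multiChoose i.1 γ = 0 :=
  multiChoose_eq_zero fun h => hi ⟨(i.1 - γ, i.2), by simp [tsub_add_cancel_of_le h]⟩

/-- Here the binomial weights arise: raising $\alpha$ by $\gamma$ multiplies the squared norm by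
$t^{|\gamma|}(\alpha+\gamma)!/\alpha!=t^{|\gamma|}\binom{\alpha+\gamma}{\gamma}\gamma!$. -/
theorem multiChoose_div_hermiteNormSq_add (ht : 0 < t) (α β γ : Fin n → ℕ) :
    multiChoose (α + γ) γ * (t ^ (∑ j, γ j) * t ^ (∑ j, γ j)) / hermiteNormSq t (α + γ) β
      = t ^ (∑ j, γ j) / (∏ j, (γ j).factorial : ℕ) / hermiteNormSq t α β := by
  have h1 := hermiteNormSq_pos ht α β
  have h2 := hermiteNormSq_pos ht (α + γ) β
  have h3 : ((∏ j, (γ j).factorial : ℕ) : ℝ) ≠ 0 := by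
    exact_mod_cast (Finset.prod_pos fun j _ => (γ j).factorial_pos).ne'
  rw [div_div, div_eq_div_iff h2.ne' (mul_ne_zero h3 h1.ne'), hermiteNormSq_add]
  ring

/-- If lowering by `γ` maps `u`, `v` to `u'`, `v'`, then `⟪u', v'⟫` is the sum of the products of
the Hermite coefficients of `u` and `v`, weighted with binomial coefficients. -/
theorem hasSum_multiChoose_mul (ht : 0 < t) (γ : Fin n → ℕ)
    {u v u' v' : Lp ℂ 2 (gaussianMeasure n t)}
    (hu : ∀ α β, hermiteCoeff t (α + γ) β u = t ^ (∑ j, γ j) * hermiteCoeff t α β u')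
    (hv : ∀ α β, hermiteCoeff t (α + γ) β v = t ^ (∑ j, γ j) * hermiteCoeff t α β v') :
    HasSum (fun i : (Fin n → ℕ) × (Fin n → ℕ) => (multiChoose i.1 γ : ℂ) *
      (star (hermiteCoeff t i.1 i.2 u) * hermiteCoeff t i.1 i.2 v / hermiteNormSq t i.1 i.2))
      ((t : ℂ) ^ (∑ j, γ j) / (∏ j, (γ j).factorial : ℕ) * inner ℂ u' v') := by
  -- Terms with $\gamma\not\le\alpha$ have zero binomial weight, so the sum is reindexed by
  -- $\alpha\mapsto\alpha+\gamma$ and becomes Parseval for `u'` and `v'`.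
  rw [← (add_prod_injective γ).hasSum_iff
    (fun i hi => by rw [multiChoose_eq_zero_of_notMem_range hi, Nat.cast_zero, zero_mul])]
  convert! (hasSum_hermiteCoeff ht u' v').mul_left _ using 2 with i
  have h := congrArg (fun x : ℝ => (x : ℂ)) (multiChoose_div_hermiteNormSq_add ht i.1 i.2 γ)
  push_cast at h
  simp only [Function.comp, hu, hv, star_mul', star_pow, Complex.star_def, Complex.conj_ofReal]
  push_cast
  linear_combination ((starRingEnd ℂ) (hermiteCoeff t i.1 i.2 u') * hermiteCoeff t i.1 i.2 v') * h

/-- The same reindexing for absolute values, with Cauchy-Schwarz in place of Parseval; used for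
$|\gamma|=k+1$ to bound the remainder. -/
theorem sum_multiChoose_mul_norm_le (ht : 0 < t) (γ : Fin n → ℕ)
    {u v u' v' : Lp ℂ 2 (gaussianMeasure n t)}
    (hu : ∀ α β, hermiteCoeff t (α + γ) β u = t ^ (∑ j, γ j) * hermiteCoeff t α β u')
    (hv : ∀ α β, hermiteCoeff t (α + γ) β v = t ^ (∑ j, γ j) * hermiteCoeff t α β v') :
    ∃ s ≤ t ^ (∑ j, γ j) / (∏ j, (γ j).factorial : ℕ) * (‖u'‖ * ‖v'‖),
      HasSum (fun i : (Fin n → ℕ) × (Fin n → ℕ) => (multiChoose i.1 γ : ℝ) *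
      (‖hermiteCoeff t i.1 i.2 u‖ * ‖hermiteCoeff t i.1 i.2 v‖ / hermiteNormSq t i.1 i.2)) s := by
  obtain ⟨h1, h2⟩ := sum_norm_hermiteCoeff_mul_le ht u' v'
  refine ⟨_, mul_le_mul_of_nonneg_left h2 (by positivity), ?_⟩
  rw [← (add_prod_injective γ).hasSum_iff
    (fun i hi => by rw [multiChoose_eq_zero_of_notMem_range hi, Nat.cast_zero, zero_mul])]
  convert! h1.hasSum.mul_left _ using 2 with i
  have h := multiChoose_div_hermiteNormSq_add ht i.1 i.2 γ
  simp only [Function.comp, hu, hv, norm_mul, norm_pow, Complex.norm_real,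
    Real.norm_of_nonneg ht.le]
  linear_combination (‖hermiteCoeff t i.1 i.2 u'‖ * ‖hermiteCoeff t i.1 i.2 v'‖) * h

end shift

/-! ### The Toeplitz product and its remainder -/

section toeplitz

variable {n : ℕ} {t : Set.Ioi (0 : ℝ)}

theorem IsCb.memLp_top {m : ℕ} {f : (Fin n → ℂ) → ℂ} (hf : IsCb m f) (t : ℝ) :
    MemLp f ⊤ (gaussianMeasure n t) := by
  obtain ⟨C, -, hC⟩ := hf.exists_bound
  exact memLp_top_of_bound hf.1.continuous.aestronglyMeasurable C (ae_of_all _ hC)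

theorem coeFn_mulOp {t : ℝ} {f : (Fin n → ℂ) → ℂ} (hf : MemLp f ⊤ (gaussianMeasure n t))
    (u : Lp ℂ 2 (gaussianMeasure n t)) :
    mulOp f hf u =ᵐ[gaussianMeasure n t] fun z => f z * u z := by
  have h := (ContinuousLinearMap.mul ℂ ℂ).coeFn_holder (r := 2) (hf.toLp f) u
  refine h.trans ?_
  filter_upwards [hf.coeFn_toLp] with z hz
  rw [hz]
  simp

theorem norm_mulOp_le {t : ℝ} {f : (Fin n → ℂ) → ℂ} (hf : MemLp f ⊤ (gaussianMeasure n t)) {C : ℝ}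
    (hC : ∀ z, ‖f z‖ ≤ C) (u : Lp ℂ 2 (gaussianMeasure n t)) : ‖mulOp f hf u‖ ≤ C * ‖u‖ := by
  refine Lp.norm_le_mul_norm_of_ae_le_mul ?_
  filter_upwards [coeFn_mulOp hf u] with z hz
  rw [hz, norm_mul]
  exact mul_le_mul_of_nonneg_right (hC z) (norm_nonneg _)

theorem toeplitz_apply {f : (Fin n → ℂ) → ℂ} (hf : MemLp f ⊤ (gaussianMeasure n t))
    (h : fockSpace n (t : ℝ)) :
    toeplitz t f h = (fockSpace n (t : ℝ)).orthogonalProjectionOnto (mulOp f hf h) := by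
  rw [toeplitz, dif_pos hf]
  rfl

theorem inner_toeplitz {f : (Fin n → ℂ) → ℂ} (hf : MemLp f ⊤ (gaussianMeasure n t))
    (h' h : fockSpace n (t : ℝ)) :
    inner ℂ (h' : Lp ℂ 2 (gaussianMeasure n t)) (toeplitz t f h)
      = inner ℂ (h' : Lp ℂ 2 (gaussianMeasure n t)) (mulOp f hf h) := by
  rw [toeplitz_apply hf]
  exact Submodule.inner_orthogonalProjectionOnto_eq_of_mem_left h' _

theorem inner_mulOp_mul {t : ℝ} {f g p : (Fin n → ℂ) → ℂ}
    (hf : MemLp (fun z => star (f z)) ⊤ (gaussianMeasure n t))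
    (hg : MemLp g ⊤ (gaussianMeasure n t)) (hp : MemLp p ⊤ (gaussianMeasure n t))
    (hfg : ∀ z, p z = f z * g z) (h' h : Lp ℂ 2 (gaussianMeasure n t)) :
    inner ℂ h' (mulOp p hp h) = inner ℂ (mulOp (fun z => star (f z)) hf h') (mulOp g hg h) := by
  rw [L2.inner_def, L2.inner_def]
  refine integral_congr_ae ?_
  filter_upwards [coeFn_mulOp hf h', coeFn_mulOp hg h, coeFn_mulOp hp h] with z h1 h2 h3
  rw [h1, h2, h3, hfg]
  simp
  ring

theorem inner_mulOp {t : ℝ} {f : (Fin n → ℂ) → ℂ}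
    (hf : MemLp (fun z => star (f z)) ⊤ (gaussianMeasure n t))
    (hf' : MemLp f ⊤ (gaussianMeasure n t)) (h' h : Lp ℂ 2 (gaussianMeasure n t)) :
    inner ℂ h' (mulOp f hf' h) = inner ℂ (mulOp (fun z => star (f z)) hf h') h := by
  rw [L2.inner_def, L2.inner_def]
  refine integral_congr_ae ?_
  filter_upwards [coeFn_mulOp hf h', coeFn_mulOp hf' h] with z h1 h3
  rw [h1, h3]
  simp
  ring

/-- For $\alpha=0$ the basis vector lies in the Fock space, so projecting does not change the
pairing; for $\alpha\ne0$ the projection is entire and its coefficient vanishes. -/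
theorem hermiteCoeff_orthogonalProjectionOnto (v : Lp ℂ 2 (gaussianMeasure n (t : ℝ)))
    (α β : Fin n → ℕ) :
    hermiteCoeff t α β ((fockSpace n (t : ℝ)).orthogonalProjectionOnto v :
      Lp ℂ 2 (gaussianMeasure n (t : ℝ))) = if α = 0 then hermiteCoeff t α β v else 0 := by
  have ht : 0 < (t : ℝ) := t.2
  split_ifs with h
  · subst h
    rw [← inner_hermiteLp ht, ← inner_hermiteLp ht]
    exact Submodule.inner_orthogonalProjectionOnto_eq_of_mem_left
      (⟨_, hermiteLp_zero_mem_fockSpace ht β⟩ : fockSpace n (t : ℝ)) v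
  · obtain ⟨F, hF, hvF⟩ := ((fockSpace n (t : ℝ)).orthogonalProjectionOnto v).2
    rw [hermiteCoeff_congr hvF]
    exact hermiteCoeff_eq_zero_of_ne_zero ht h β hF ((memLp_congr_ae hvF).1 (Lp.memLp _))

theorem hermiteCoeff_mulOp_add (γ : Fin n → ℕ) {g : (Fin n → ℂ) → ℂ} (hg : IsCb (∑ j, γ j) g)
    (hg0 : MemLp g ⊤ (gaussianMeasure n t)) (hgγ : MemLp (wirtingerBarPow γ g) ⊤ (gaussianMeasure n t))
    (h : fockSpace n (t : ℝ)) (α β : Fin n → ℕ) :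
    hermiteCoeff t (α + γ) β (mulOp g hg0 h)
      = ((t : ℝ) : ℂ) ^ (∑ j, γ j) * hermiteCoeff t α β (mulOp (wirtingerBarPow γ g) hgγ h) := by
  obtain ⟨F, hF, hhF⟩ := h.2
  have e : ∀ (p : (Fin n → ℂ) → ℂ) (hp : MemLp p ⊤ (gaussianMeasure n t)),
      mulOp p hp h =ᵐ[gaussianMeasure n t] fun z => p z * F z := fun p hp => by
    filter_upwards [coeFn_mulOp hp h, hhF] with z h1 h2
    rw [h1, h2]
  rw [hermiteCoeff_congr (e g hg0), hermiteCoeff_congr (e _ hgγ)]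
  exact hermiteCoeff_add_mul t.2 α β γ hg hF ((memLp_congr_ae hhF).1 (Lp.memLp _))

/-- The witnesses are $(\bar\partial^\gamma\bar f)h'$ and $(\bar\partial^\gamma g)h$; their inner
product is the matrix coefficient of the Toeplitz operator with symbol $\partial^\gamma
f\,\bar\partial^\gamma g$. -/
theorem exists_lowered {k : ℕ} {f g : (Fin n → ℂ) → ℂ} (hf : IsCb (k + 1) f)
    (hg : IsCb (k + 1) g) {γ : Fin n → ℕ} (hγ : ∑ j, γ j ≤ k + 1) {K M : ℝ}
    (hK : ∀ z, ‖wirtingerPow γ f z‖ ≤ K) (hM : ∀ z, ‖wirtingerBarPow γ g z‖ ≤ M)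
    (h' h : fockSpace n (t : ℝ)) : ∃ u' v' : Lp ℂ 2 (gaussianMeasure n (t : ℝ)),
      (∀ α β, hermiteCoeff t (α + γ) β (mulOp _ (hf.star.memLp_top t) h')
        = ((t : ℝ) : ℂ) ^ (∑ j, γ j) * hermiteCoeff t α β u') ∧
      (∀ α β, hermiteCoeff t (α + γ) β (mulOp _ (hg.memLp_top t) h)
        = ((t : ℝ) : ℂ) ^ (∑ j, γ j) * hermiteCoeff t α β v') ∧
      inner ℂ (h' : Lp ℂ 2 (gaussianMeasure n (t : ℝ)))
        (toeplitz t (fun z => wirtingerPow γ f z * wirtingerBarPow γ g z) h)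
        = inner ℂ u' v' ∧ ‖u'‖ ≤ K * ‖h'‖ ∧ ‖v'‖ ≤ M * ‖h‖ := by
  have hfγ : IsCb 0 (wirtingerBarPow γ fun z => star (f z)) :=
    (hf.star.mono (by omega)).wirtingerBarPow γ
  have hgγ : IsCb 0 (wirtingerBarPow γ g) := (hg.mono (by omega)).wirtingerBarPow γ
  have hf1 := hermiteCoeff_mulOp_add γ (hf.star.mono hγ) (hf.star.memLp_top t)
    (hfγ.memLp_top t) h'
  rw [wirtingerBarPow_star] at hfγ
  have e : ∀ hp, mulOp (wirtingerBarPow γ fun z => star (f z)) hp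
      = mulOp (t := t) (fun z => star (wirtingerPow γ f z)) (hfγ.memLp_top t) := by
    rw [wirtingerBarPow_star]
    exact fun _ => rfl
  rw [e] at hf1
  -- Boundedness of the product symbol excludes the default value `0` in `toeplitz`.
  have hp : MemLp (fun z => wirtingerPow γ f z * wirtingerBarPow γ g z) ⊤
      (gaussianMeasure n (t : ℝ)) := by
    have h1 : MemLp (wirtingerPow γ f) ⊤ (gaussianMeasure n (t : ℝ)) := by
      convert! (hfγ.memLp_top t).star using 1
      ext z
      simp
    exact (hgγ.memLp_top t).mul h1
  refine ⟨mulOp _ (hfγ.memLp_top t) h', mulOp _ (hgγ.memLp_top t) h, hf1,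
    hermiteCoeff_mulOp_add γ (hg.mono hγ) _ _ h, ?_, ?_, ?_⟩
  · rw [inner_toeplitz hp]
    exact inner_mulOp_mul _ _ hp (fun z => rfl) _ _
  · exact norm_mulOp_le _ (fun z => by simpa using hK z) _
  · exact norm_mulOp_le _ hM _

/-- The remainder of order `k` in the asymptotic expansion of `T_f T_g`. -/
theorem norm_inner_toeplitz_sub_le {k : ℕ} {f g : (Fin n → ℂ) → ℂ} (hf : IsCb (k + 1) f)
    (hg : IsCb (k + 1) g) {K M : (Fin n → ℕ) → ℝ}
    (hK : ∀ γ, ∑ j, γ j ≤ k + 1 → ∀ z, ‖wirtingerPow γ f z‖ ≤ K γ)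
    (hM : ∀ γ, ∑ j, γ j ≤ k + 1 → ∀ z, ‖wirtingerBarPow γ g z‖ ≤ M γ)
    (t : Set.Ioi (0 : ℝ)) (h' h : fockSpace n (t : ℝ)) :
    ‖inner ℂ (h' : Lp ℂ 2 (gaussianMeasure n (t : ℝ))) ((toeplitz t f ∘L toeplitz t g - ∑ α ∈ multiIndices n k,
      ((-((t : ℝ) : ℂ)) ^ (∑ j, α j) / ((∏ j, (α j).factorial : ℕ) : ℂ)) •
        toeplitz t (fun z => wirtingerPow α f z * wirtingerBarPow α g z)) h)‖
      ≤ (∑ γ ∈ Finset.univ.piAntidiag (k + 1), K γ * M γ) * (t : ℝ) ^ (k + 1)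
        * (‖h'‖ * ‖h‖) := by
  have ht : 0 < (t : ℝ) := t.2
  set u := mulOp _ (hf.star.memLp_top t) (h' : Lp ℂ 2 (gaussianMeasure n (t : ℝ))) with hu
  set v := mulOp _ (hg.memLp_top t) (h : Lp ℂ 2 (gaussianMeasure n (t : ℝ))) with hv
  choose! u' v' hu' hv' huv hun hvn using fun γ (hγ : ∑ j, γ j ≤ k + 1) =>
    exists_lowered (γ := γ) hf hg hγ (hK γ hγ) (hM γ hγ) h' h
  set q : (Fin n → ℕ) × (Fin n → ℕ) → ℂ := fun i =>
    star (hermiteCoeff t i.1 i.2 u) * hermiteCoeff t i.1 i.2 v / hermiteNormSq t i.1 i.2 with hq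
  -- Moving $f$ to the left gives $\langle\bar fh',P(gh)\rangle$, and $P$ keeps only the
  -- coefficients with $\alpha=0$.
  have hmain : HasSum (fun i => (if i.1 = 0 then 1 else 0) * q i)
      (inner ℂ (h' : Lp ℂ 2 (gaussianMeasure n (t : ℝ))) ((toeplitz t f ∘L toeplitz t g) h)) := by
    rw [ContinuousLinearMap.comp_apply, inner_toeplitz (hf.memLp_top t),
      inner_mulOp (hf.star.memLp_top t), toeplitz_apply (hg.memLp_top t)]
    convert! hasSum_hermiteCoeff ht _ _ using 2 with i
    rw [hermiteCoeff_orthogonalProjectionOnto]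
    split_ifs <;> simp [hq, hu, hv]
  have hterms : HasSum (fun i => ∑ γ ∈ multiIndices n k,
      (-1) ^ (∑ j, γ j) * ((multiChoose i.1 γ : ℂ) * q i))
      (∑ γ ∈ multiIndices n k, inner ℂ (h' : Lp ℂ 2 (gaussianMeasure n (t : ℝ)))
        (((-((t : ℝ) : ℂ)) ^ (∑ j, γ j) / ((∏ j, (γ j).factorial : ℕ) : ℂ)) •
          (toeplitz t (fun z => wirtingerPow γ f z * wirtingerBarPow γ g z) h :
            Lp ℂ 2 (gaussianMeasure n (t : ℝ))))) := by
    refine hasSum_sum fun γ hγ => ?_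
    have hγ' : ∑ j, γ j ≤ k + 1 := (mem_multiIndices.1 hγ).trans (Nat.le_succ k)
    convert! (hasSum_multiChoose_mul ht γ (hu' γ hγ') (hv' γ hγ')).mul_left
      ((-1) ^ (∑ j, γ j)) using 1
    rw [inner_smul_right, huv γ hγ', neg_pow]
    ring
  have hD := hmain.sub hterms
  rw [← inner_sum, ← inner_sub_right] at hD
  choose! s hs hsum using fun γ (hγ : ∑ j, γ j ≤ k + 1) =>
    sum_multiChoose_mul_norm_le ht γ (hu' γ hγ) (hv' γ hγ)
  have hB : HasSum (fun i : (Fin n → ℕ) × (Fin n → ℕ) => ∑ γ ∈ Finset.univ.piAntidiag (k + 1),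
      (multiChoose i.1 γ : ℝ) * (‖hermiteCoeff t i.1 i.2 u‖ * ‖hermiteCoeff t i.1 i.2 v‖
        / hermiteNormSq t i.1 i.2)) (∑ γ ∈ Finset.univ.piAntidiag (k + 1), s γ) :=
    hasSum_sum fun γ hγ => hsum γ (Finset.mem_piAntidiag.1 hγ).1.le
  have hle := hD.norm_le_of_bounded hB fun i => ?_
  · simp only [sub_apply, sum_apply, smul_apply,
      Submodule.coe_sub, Submodule.coe_sum, Submodule.coe_smul]
    refine hle.trans ?_
    rw [Finset.sum_mul, Finset.sum_mul]
    refine Finset.sum_le_sum fun γ hγ => ?_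
    have hγ' := (Finset.mem_piAntidiag.1 hγ).1
    refine (hs γ hγ'.le).trans ?_
    have h1 := hun γ hγ'.le
    have h2 := hvn γ hγ'.le
    -- The gain $1/\gamma!$ is discarded, which leaves the constant $\sum_\gamma K_\gamma M_\gamma$.
    have h3 : (1 : ℝ) ≤ (∏ j, (γ j).factorial : ℕ) := by
      exact_mod_cast Nat.one_le_iff_ne_zero.2 (Finset.prod_pos fun j _ => (γ j).factorial_pos).ne'
    calc _ ≤ (t : ℝ) ^ (∑ j, γ j) * ((K γ * ‖h'‖) * (M γ * ‖h‖)) := by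
          refine mul_le_mul (div_le_self (by positivity) h3) ?_ (by positivity) (by positivity)
          exact mul_le_mul h1 h2 (norm_nonneg _) ((norm_nonneg _).trans h1)
      _ = _ := by
          rw [hγ']
          ring
  -- Termwise, the difference is an integer multiple of `q i`, and truncated inclusion-exclusion
  -- bounds that integer.
  · have hw := abs_alternating_sum_multiChoose_le k i.1
    have e : (if i.1 = 0 then 1 else 0) * q i - ∑ γ ∈ multiIndices n k,
        (-1) ^ (∑ j, γ j) * ((multiChoose i.1 γ : ℂ) * q i)
        = (((if i.1 = 0 then 1 else 0 : ℤ) - ∑ γ ∈ multiIndices n k,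
          (-1) ^ (∑ j, γ j) * (multiChoose i.1 γ : ℤ) : ℤ) : ℂ) * q i := by
      push_cast
      rw [sub_mul, Finset.sum_mul]
      simp only [mul_assoc]
    have hqn : ‖q i‖ = ‖hermiteCoeff t i.1 i.2 u‖ * ‖hermiteCoeff t i.1 i.2 v‖
        / hermiteNormSq t i.1 i.2 := by
      simp only [hq, norm_div, norm_mul, norm_star, Complex.norm_real,
        Real.norm_of_nonneg (hermiteNormSq_pos ht i.1 i.2).le]
    rw [e, norm_mul, hqn, ← Finset.sum_mul, Complex.norm_intCast]
    have := hermiteNormSq_pos ht i.1 i.2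
    refine mul_le_mul_of_nonneg_right ?_ (by positivity)
    exact_mod_cast hw

theorem norm_toeplitz_sub_le {k : ℕ} {f g : (Fin n → ℂ) → ℂ} (hf : IsCb (k + 1) f)
    (hg : IsCb (k + 1) g) : ∃ C : ℝ, ∀ t : Set.Ioi (0 : ℝ),
    ‖toeplitz t f ∘L toeplitz t g - ∑ α ∈ multiIndices n k,
      ((-((t : ℝ) : ℂ)) ^ (∑ j, α j) / ((∏ j, (α j).factorial : ℕ) : ℂ)) •
        toeplitz t (fun z => wirtingerPow α f z * wirtingerBarPow α g z)‖
      ≤ C * (t : ℝ) ^ (k + 1) := by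
  have hK : ∀ γ : Fin n → ℕ, ∑ j, γ j ≤ k + 1 →
      ∃ C, 0 ≤ C ∧ ∀ z, ‖wirtingerPow γ f z‖ ≤ C := fun γ hγ => by
    have h1 : IsCb 0 (wirtingerBarPow γ fun z => star (f z)) :=
      (hf.star.mono (by omega)).wirtingerBarPow γ
    rw [wirtingerBarPow_star] at h1
    simpa using h1.exists_bound
  have hM : ∀ γ : Fin n → ℕ, ∑ j, γ j ≤ k + 1 →
      ∃ C, 0 ≤ C ∧ ∀ z, ‖wirtingerBarPow γ g z‖ ≤ C := fun γ hγ =>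
    IsCb.exists_bound (m := 0) ((hg.mono (by omega)).wirtingerBarPow γ)
  choose! K hK0 hK using hK
  choose! M hM0 hM using hM
  refine ⟨∑ γ ∈ Finset.univ.piAntidiag (k + 1), K γ * M γ, fun t => ?_⟩
  have ht : 0 < (t : ℝ) := t.2
  refine ContinuousLinearMap.opNorm_le_bound _ (mul_nonneg (Finset.sum_nonneg fun γ hγ => ?_)
    (by positivity)) fun h => ?_
  · have hγ := (Finset.mem_piAntidiag.1 hγ).1.le
    exact mul_nonneg (hK0 γ hγ) (hM0 γ hγ)
  · set D := toeplitz t f ∘L toeplitz t g - ∑ α ∈ multiIndices n k,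
      ((-((t : ℝ) : ℂ)) ^ (∑ j, α j) / ((∏ j, (α j).factorial : ℕ) : ℂ)) •
        toeplitz t (fun z => wirtingerPow α f z * wirtingerBarPow α g z) with hD
    -- Testing the sesquilinear bound against `D h` itself yields the operator norm after division
    -- by `‖D h‖`.
    have h1 := norm_inner_toeplitz_sub_le hf hg hK hM t (D h) h
    rw [← hD, inner_self_eq_norm_sq_to_K, Submodule.norm_coe] at h1
    rcases eq_or_ne ‖D h‖ 0 with h0 | h0
    · rw [h0]
      refine mul_nonneg (mul_nonneg (Finset.sum_nonneg fun γ hγ => ?_) (by positivity))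
        (norm_nonneg _)
      have hγ := (Finset.mem_piAntidiag.1 hγ).1.le
      exact mul_nonneg (hK0 γ hγ) (hM0 γ hγ)
    · have hpos : 0 < ‖D h‖ := (norm_nonneg _).lt_of_ne h0.symm
      refine le_of_mul_le_mul_left ?_ hpos
      simp only [norm_pow, RCLike.norm_ofReal, abs_norm] at h1
      calc ‖D h‖ * ‖D h‖ = ‖D h‖ ^ 2 := (sq _).symm
        _ ≤ _ := h1
        _ = _ := by ring

end toeplitz

end FockToeplitz

theorem theorem1 (n k : ℕ) (hk : 1 ≤ k) (f g : (Fin n → ℂ) → ℂ)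
    (hf : FockToeplitz.IsCb (2 * k) f) (hg : FockToeplitz.IsCb (2 * k) g) :
    (fun t : Set.Ioi (0 : ℝ) =>
        ‖(FockToeplitz.toeplitz t f) ∘L (FockToeplitz.toeplitz t g)
          - ∑ α ∈ FockToeplitz.multiIndices n k,
              ((-((t : ℝ) : ℂ)) ^ (∑ j, α j) / ((∏ j, (α j).factorial : ℕ) : ℂ)) •
                FockToeplitz.toeplitz t
                  (fun z => FockToeplitz.wirtingerPow α f z * FockToeplitz.wirtingerBarPow α g z)‖)
      =o[Filter.comap (fun t : Set.Ioi (0 : ℝ) => (t : ℝ)) (nhds 0)]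
        (fun t : Set.Ioi (0 : ℝ) => (t : ℝ) ^ k) := by
  -- The only place where $k\ge1$ enters: the remainder estimate needs $k+1\le2k$ bounded
  -- derivatives.
  obtain ⟨C, hC⟩ := FockToeplitz.norm_toeplitz_sub_le (hf.mono (by omega : k + 1 ≤ 2 * k))
    (hg.mono (by omega : k + 1 ≤ 2 * k))
  have h1 : (fun t : Set.Ioi (0 : ℝ) => (t : ℝ) ^ (k + 1))
      =o[Filter.comap (fun t : Set.Ioi (0 : ℝ) => (t : ℝ)) (nhds 0)]
        (fun t : Set.Ioi (0 : ℝ) => (t : ℝ) ^ k) :=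
    (Asymptotics.isLittleO_pow_pow (𝕜 := ℝ) (Nat.lt_succ_self k)).comp_tendsto tendsto_comap
  refine Asymptotics.IsBigO.trans_isLittleO
    (Asymptotics.IsBigO.of_bound C (Eventually.of_forall fun t => ?_)) h1
  have ht : 0 < (t : ℝ) := t.2
  rw [Real.norm_of_nonneg (show 0 ≤ (t : ℝ) ^ (k + 1) by positivity)]
  exact (abs_of_nonneg (ContinuousLinearMap.opNorm_nonneg _)).trans_le (hC t)
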